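/- Let $\mathbb{G}=(\mathbb{R}^n,\cdot)$ be a Carnot group in exponential coordinates: the group law is $x\cdot y=x+y+P(x,y)$ with $P$ polynomial, $0$ is the neutral element and $x^{-1}=-x$; the coordinates carry integer weights $\alpha_i\ge 1$, the components of $P$ of weight $1$ vanish, the dilations $\delta_\lambda(x)=(\lambda^{\alpha_1}x_1,\dots,\lambda^{\alpha_n}x_n)$, $\lambda>0$, are group automorphisms, and, with $V_i$ the span of the left invariant vector fields that equal $\partial_j$ at $0$ for some $j$ with $\alpha_j=i$, the Lie algebra is stratified: $[V_1,V_i]=V_{i+1}$ for all $i\ge 1$ (with $V_i=0$ for $i$ larger than all weights). Let $Q=\sum_i i\dim V_i$ be the homogeneous dimension and assume $Q\ge 3$. Let $X_j$, for $j$ with $\alpha_j=1$, be the left invariant vector fields with $X_j(0)=\partial_j$, and put $\nabla_{\mathbb{G}}=(X_j)_j$ and $\Delta_{\mathbb{G}}=\sum_j X_j^2$. A homogeneous norm is a continuous function $\mathbb{G}\to[0,\infty)$, smooth on $\mathbb{G}\setminus\{0\}$, vanishing exactly at $0$, invariant under $x\mapsto x^{-1}$, and homogeneous of degree one under the dilations.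 Let $u$ be Folland's fundamental solution of $-\Delta_{\mathbb{G}}$, that is, the locally integrable function with $-\Delta_{\mathbb{G}}u=\delta_0$ in the sense of distributions that on $\mathbb{G}\setminus\{0\}$ has the form $M^{2-Q}$ with $M$ a homogeneous norm. Let $N=u^{1/(2-Q)}$ on $\mathbb{G}\setminus\{0\}$ and $N(0)=0$. Assume that $\mathbb{G}$ is polarizable, that is, $$\tfrac12\big\langle\nabla_{\mathbb{G}}(|\nabla_{\mathbb{G}}N|^2),\nabla_{\mathbb{G}}N\big\rangle=0\quad\text{in }\mathbb{G}\setminus\{0\}.$$ Let $1<p<Q$. Then for every real-valued $\phi\in C_0^\infty(\mathbb{G}\setminus\{0\})$ the two integrals below (with respect to Lebesgue measure) are finite and $$\int_{\mathbb{G}}|\nabla_{\mathbb{G}}\phi|^p\,dx\ \ge\ \Big(\frac{Q-p}{p}\Big)^p\int_{\mathbb{G}}\frac{|\nabla_{\mathbb{G}}N|^p}{N^p}|\phi|^p\,dx .$$ Moreover the constant is sharp: if $C\in\mathbb{R}$ is such that $\int_{\mathbb{G}}|\nabla_{\mathbb{G}}\phi|^p\,dx\ge C\int_{\mathbb{G}}\frac{|\nabla_{\mathbb{G}}N|^p}{N^p}|\phi|^p\,dx$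 for every $\phi\in C_0^\infty(\mathbb{G}\setminus\{0\})$, then $C\le\big(\frac{Q-p}{p}\big)^p$. -/

import Mathlib

open MeasureTheory Set
open scoped ContDiff

noncomputable section

/-- Anisotropic dilation of `ℝⁿ`: `δ_r (x₁, …, xₙ) = (r^{α₁} x₁, …, r^{αₙ} xₙ)`. -/
def anisotropicDilation {n : ℕ} (α : Fin n → ℕ) (r : ℝ) (x : Fin n → ℝ) : Fin n → ℝ :=
  fun i => r ^ α i * x i

/-- The vector field on `ℝⁿ` with value `v` at `0` that is invariant under the left translations
of the law `mul`: its value at `x` is the image of `v` under the differential at `0` of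
`y ↦ x · y`. -/
def leftInvariantField {n : ℕ} (mul : (Fin n → ℝ) → (Fin n → ℝ) → (Fin n → ℝ))
    (v : Fin n → ℝ) (x : Fin n → ℝ) : Fin n → ℝ :=
  fderiv ℝ (fun y => mul x y) 0 v

/-- The bracket of the Lie algebra of `(ℝⁿ, mul)`, transported to the tangent space `ℝⁿ` at `0`
through the identification of a left invariant field with its value at `0`. -/
def tangentBracket {n : ℕ} (mul : (Fin n → ℝ) → (Fin n → ℝ) → (Fin n → ℝ))
    (v w : Fin n → ℝ) : Fin n → ℝ :=
  VectorField.lieBracket ℝ (leftInvariantField mul v) (leftInvariantField mul w) 0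

/-- The span `V_i` of the coordinate directions of weight `i`. -/
def weightLayer {n : ℕ} (α : Fin n → ℕ) (i : ℕ) : Submodule ℝ (Fin n → ℝ) :=
  Submodule.span ℝ {v | ∃ j, α j = i ∧ v = Pi.single j 1}

/-- A Carnot group `(ℝⁿ, ·)` in exponential coordinates: a polynomial group law
`x · y = x + y + P(x, y)` with neutral element `0` and inverse `-x`, for which the dilations are
automorphisms, and whose Lie algebra is stratified by the layers `V_i` of the coordinates of
weight `i`.  As all weights are positive, `ℝⁿ` is the direct sum of `V_1, …, V_k`, where `k` is the
largest weight; as `V_i = 0` for `i > k`, the field `stratified` says that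
`[V_1, V_i] = V_{i+1}` for `1 ≤ i < k` and `[V_1, V_k] = 0`. -/
structure CarnotGroup (n : ℕ) where
  /-- The weights `α₁, …, αₙ` of the coordinates. -/
  weight : Fin n → ℕ
  /-- The group law. -/
  mul : (Fin n → ℝ) → (Fin n → ℝ) → (Fin n → ℝ)
  one_le_weight : ∀ i, 1 ≤ weight i
  mul_assoc : ∀ x y z, mul (mul x y) z = mul x (mul y z)
  zero_mul : ∀ x, mul 0 x = x
  mul_zero : ∀ x, mul x 0 = x
  neg_mul_cancel : ∀ x, mul (-x) x = 0
  mul_neg_cancel : ∀ x, mul x (-x) = 0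
  polynomial_law : ∀ i, ∃ P : MvPolynomial (Fin n ⊕ Fin n) ℝ,
    ∀ x y, mul x y i = x i + y i + MvPolynomial.eval (Sum.elim x y) P
  mul_horizontal : ∀ i, weight i = 1 → ∀ x y, mul x y i = x i + y i
  dilation_mul : ∀ r : ℝ, 0 < r → ∀ x y,
    mul (anisotropicDilation weight r x) (anisotropicDilation weight r y) =
      anisotropicDilation weight r (mul x y)
  stratified : ∀ i, 1 ≤ i →
    Submodule.span ℝ {z | ∃ v ∈ weightLayer weight 1, ∃ w ∈ weightLayer weight i,
      z = tangentBracket mul v w} = weightLayer weight (i + 1)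

namespace CarnotGroup

variable {n : ℕ} (G : CarnotGroup n)

/-- The homogeneous dimension `Q = ∑ j (dim V_j)`: each coordinate of weight `j` contributes `j`. -/
def homDim : ℕ := ∑ i, G.weight i

/-- The dilation `δ_r`. -/
def dilation (r : ℝ) (x : Fin n → ℝ) : Fin n → ℝ := anisotropicDilation G.weight r x

/-- The indices of the first layer `V_1`. -/
def horizontal : Finset (Fin n) := Finset.univ.filter fun j => G.weight j = 1

/-- The derivative `X_j f`, where `X_j` is the left invariant vector field with
`X_j(0) = ∂_j`. -/
def X (j : Fin n) (f : (Fin n → ℝ) → ℝ) (x : Fin n → ℝ) : ℝ :=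
  fderiv ℝ f x (leftInvariantField G.mul (Pi.single j 1) x)

/-- The inner product `⟨∇_G f, ∇_G g⟩` of horizontal gradients, `∇_G = (X_j)_{j horizontal}`. -/
def gradInner (f g : (Fin n → ℝ) → ℝ) (x : Fin n → ℝ) : ℝ :=
  ∑ j ∈ G.horizontal, G.X j f x * G.X j g x

/-- The length `|∇_G f|` of the horizontal gradient. -/
def gradNorm (f : (Fin n → ℝ) → ℝ) (x : Fin n → ℝ) : ℝ :=
  Real.sqrt (∑ j ∈ G.horizontal, G.X j f x ^ 2)

/-- The sub-Laplacian `Δ_G = ∑ X_j²`. -/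
def subLaplacian (f : (Fin n → ℝ) → ℝ) (x : Fin n → ℝ) : ℝ :=
  ∑ j ∈ G.horizontal, G.X j (G.X j f) x

/-- The `∞`-sub-Laplacian `Δ_{G,∞} f = ½ ⟨∇_G (|∇_G f|²), ∇_G f⟩`. -/
def infSubLaplacian (f : (Fin n → ℝ) → ℝ) (x : Fin n → ℝ) : ℝ :=
  1 / 2 * G.gradInner (fun y => G.gradNorm f y ^ 2) f x

/-- Homogeneous norms: continuous, nonnegative, smooth away from `0`, homogeneous of degree one,
symmetric under `x ↦ x⁻¹ = -x`, and vanishing only at `0`. -/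
structure IsHomogeneousNorm (N : (Fin n → ℝ) → ℝ) : Prop where
  continuous : Continuous N
  nonneg : ∀ x, 0 ≤ N x
  smooth : ContDiffOn ℝ ∞ N {0}ᶜ
  dilation : ∀ r : ℝ, 0 < r → ∀ x, N (G.dilation r x) = r * N x
  inv : ∀ x, N (-x) = N x
  eq_zero_iff : ∀ x, N x = 0 ↔ x = 0

/-- `-Δ_G u = δ_0` in the sense of distributions.  (`Δ_G` is formally self-adjoint for Lebesgue
measure, which is the Haar measure of the group.) -/
structure IsFundamentalSolution (u : (Fin n → ℝ) → ℝ) : Prop where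
  locallyIntegrable : LocallyIntegrable u
  weak_eq : ∀ f : (Fin n → ℝ) → ℝ, ContDiff ℝ ∞ f → HasCompactSupport f →
    -∫ x, u x * G.subLaplacian f x = f 0

/-- Folland's solution: the fundamental solution of the form `u = N^{2-Q}` away from the origin,
with `N` a homogeneous norm. -/
structure IsFollandSolution (u : (Fin n → ℝ) → ℝ) : Prop where
  fundamental : G.IsFundamentalSolution u
  eq_norm_rpow : ∃ N : (Fin n → ℝ) → ℝ, G.IsHomogeneousNorm N ∧
    ∀ x, x ≠ 0 → u x = N x ^ (2 - (G.homDim : ℝ))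

/-- The gauge of `u`: `u^{1/(2-Q)}` away from the origin and `0` at the origin. -/
def gauge (u : (Fin n → ℝ) → ℝ) (x : Fin n → ℝ) : ℝ :=
  open Classical in if x = 0 then 0 else u x ^ (1 / (2 - (G.homDim : ℝ)))

/-- `G` is polarizable if the gauge of Folland's solution is `∞`-harmonic away from the origin. -/
def IsPolarizable : Prop :=
  ∀ u : (Fin n → ℝ) → ℝ, G.IsFollandSolution u →
    ∀ x, x ≠ 0 → G.infSubLaplacian (G.gauge u) x = 0

end CarnotGroup

/-- `C_0^∞(ℝⁿ ∖ {0})`: smooth functions with compact support contained in `ℝⁿ ∖ {0}`. -/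
structure IsPuncturedTestFunction {n : ℕ} (φ : (Fin n → ℝ) → ℝ) : Prop where
  smooth : ContDiff ℝ ∞ φ
  compact : HasCompactSupport φ
  support : tsupport φ ⊆ {0}ᶜ

end

/-! The inequality comes from one vector field. Away from `0` the solution u = N^{2-Q} is harmonic,
which reads N Δ_G N = (Q-1)|∇_G N|² (`gauge_mul_subLaplacian`). Polarizability makes every function
of |∇_G N|² constant to first order along ∇_G N. Hence, formally, |∇_G N|^{p-2} N^{1-p} ∇_G N has
horizontal divergence (Q-p)|∇_G N|^p N^{-p}. Testing with |φ|^p, integrating by parts and applying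
Cauchy-Schwarz bounds the Hardy integral by p/(Q-p) times ∫ |∇_G N|^{p-1} N^{1-p} |φ|^{p-1} |∇_G φ|;
Young's inequality with weight a = (Q-p)/p then gives the constant a^p (`IsHomogeneousNorm.hardy`).
As ∇_G N may vanish, |∇_G N|^{p-2} is replaced by (|∇_G N|²+ε)^{(p-2)/2}, which leaves the
divergence identity intact (`sum_X_weighted_gradient`), and ε tends to 0 under the integral.
Integration by parts rests on `integral_X_eq_zero`.

For sharpness, the measure |∇_G N|^p N^{-Q} dx is dilation invariant, so its image under log N is
translation invariant on ℝ, that is, c dt (`exists_integral_comp_log`). Here c > 0: were ∇_G N zero,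
a cutoff of N would be a test function annihilated by Δ_G with value 1 at `0`, against -Δ_G u = δ_0.
On the radial functions N^{-a} χ(ε log N) the Hardy quotient becomes ∫|εχ' - aχ|^p / ∫|χ|^p, which
tends to a^p (`hardy_sharp`). -/

theorem contDiff_mvPolynomial_eval {σ E : Type*} [NormedAddCommGroup E] [NormedSpace ℝ E]
    (P : MvPolynomial σ ℝ) {f : E → σ → ℝ} (hf : ∀ i, ContDiff ℝ ∞ fun x => f x i) :
    ContDiff ℝ ∞ fun x => MvPolynomial.eval (f x) P := by
  induction P using MvPolynomial.induction_on with
  | C a => simpa using contDiff_const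
  | add p q hp hq => simpa using hp.add hq
  | mul_X p i hp => simpa using hp.mul (hf i)

theorem anisotropicDilation_tendsto_zero {n : ℕ} {α : Fin n → ℕ} (hα : ∀ i, 1 ≤ α i)
    (x : Fin n → ℝ) :
    Filter.Tendsto (fun r => anisotropicDilation α r x) (nhdsWithin 0 (Ioi 0)) (nhds 0) := by
  have h : Continuous fun r => anisotropicDilation α r x := by
    unfold anisotropicDilation; fun_prop
  have h0 : anisotropicDilation α 0 x = 0 := by
    funext i
    have := hα i
    simp [anisotropicDilation, show α i ≠ 0 by omega]
  simpa [h0] using (h.tendsto 0).mono_left nhdsWithin_le_nhds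

/-- The dilation as a continuous linear map. -/
noncomputable def anisotropicDilationCLM {n : ℕ} (α : Fin n → ℕ) (r : ℝ) :
    (Fin n → ℝ) →L[ℝ] (Fin n → ℝ) :=
  ContinuousLinearMap.pi fun i => (r ^ α i) • ContinuousLinearMap.proj i

theorem anisotropicDilationCLM_apply {n : ℕ} (α : Fin n → ℕ) (r : ℝ) (x : Fin n → ℝ) :
    anisotropicDilationCLM α r x = anisotropicDilation α r x := by
  funext i; simp [anisotropicDilationCLM, anisotropicDilation]

theorem anisotropicDilation_single {n : ℕ} (α : Fin n → ℕ) (r : ℝ) (j : Fin n) :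
    anisotropicDilation α r (Pi.single j 1) = r ^ α j • Pi.single j (1 : ℝ) := by
  funext i
  by_cases h : i = j
  · subst h; simp [anisotropicDilation]
  · simp [anisotropicDilation, h]

/-! ### Left invariant fields: smoothness, homogeneity, zero divergence -/

namespace CarnotGroup

variable {n : ℕ} (G : CarnotGroup n)

theorem contDiff_mul :
    ContDiff ℝ ∞ fun z : (Fin n → ℝ) × (Fin n → ℝ) => G.mul z.1 z.2 := by
  refine contDiff_pi.2 fun i => ?_
  obtain ⟨P, hP⟩ := G.polynomial_law i
  simp only [hP]
  refine ContDiff.add (by fun_prop) (contDiff_mvPolynomial_eval P ?_)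
  rintro (k | k) <;> simp only [Sum.elim_inl, Sum.elim_inr] <;> fun_prop

theorem contDiff_leftInvariantField (v : Fin n → ℝ) :
    ContDiff ℝ ∞ (leftInvariantField G.mul v) :=
  (ContDiff.fderiv (f := G.mul) (g := fun _ => 0) (m := ∞) G.contDiff_mul contDiff_const
    (by simp)).clm_apply contDiff_const

theorem differentiable_mul_left (x : Fin n → ℝ) : Differentiable ℝ fun y => G.mul x y :=
  (G.contDiff_mul.comp (contDiff_prodMk_right x)).differentiable (by simp)

/-- The left invariant fields are homogeneous under the dilations. -/
theorem leftInvariantField_dilation {r : ℝ} (hr : 0 < r) (j : Fin n) (x : Fin n → ℝ) :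
    r ^ G.weight j • leftInvariantField G.mul (Pi.single j 1) (G.dilation r x) =
      G.dilation r (leftInvariantField G.mul (Pi.single j 1) x) := by
  set D := anisotropicDilationCLM G.weight r
  have hD : ∀ y, D y = anisotropicDilation G.weight r y := anisotropicDilationCLM_apply _ _
  have h1 : (fun y => G.mul (D x) (D y)) = fun y => D (G.mul x y) := by
    funext y; rw [hD, hD, hD, G.dilation_mul r hr]
  have h2 : HasFDerivAt (fun y => G.mul (D x) (D y))
      ((fderiv ℝ (fun y => G.mul (D x) y) (D 0)).comp D) 0 :=
    (G.differentiable_mul_left (D x) (D 0)).hasFDerivAt.comp (0 : Fin n → ℝ) D.hasFDerivAt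
  have h3 : HasFDerivAt (fun y => D (G.mul x y))
      (D.comp (fderiv ℝ (fun y => G.mul x y) 0)) 0 :=
    D.hasFDerivAt.comp 0 (G.differentiable_mul_left x 0).hasFDerivAt
  rw [h1, map_zero] at h2
  have h4 := congrArg (fun L => L (Pi.single j 1)) (h2.unique h3)
  simp only [ContinuousLinearMap.comp_apply, hD, anisotropicDilation_single,
    map_smul] at h4
  exact h4

/-- The left invariant fields are divergence free, coordinate by coordinate. -/
theorem fderiv_leftInvariantField_diag (j k : Fin n) (x : Fin n → ℝ) :
    fderiv ℝ (fun y => leftInvariantField G.mul (Pi.single j 1) y k) x (Pi.single k 1) = 0 := by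
  set a : (Fin n → ℝ) → ℝ := fun y => leftInvariantField G.mul (Pi.single j 1) y k with ha
  have hsm : ContDiff ℝ ∞ a := contDiff_pi.1 (G.contDiff_leftInvariantField _) k
  have hd : Differentiable ℝ a := hsm.differentiable (by simp)
  -- The coefficient is homogeneous of degree α_k - α_j, so its `k`-th partial derivative has degree
  -- -α_j < 0. A function of negative degree that is continuous at the origin must vanish: let r
  -- tend to 0.
  have key : ∀ r : ℝ, 0 < r → r ^ G.weight j *
      fderiv ℝ a (G.dilation r x) (Pi.single k 1) = fderiv ℝ a x (Pi.single k 1) := by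
    intro r hr
    set D := anisotropicDilationCLM G.weight r
    have hD : ∀ y, D y = anisotropicDilation G.weight r y := anisotropicDilationCLM_apply _ _
    have h1 : (fun y => r ^ G.weight j * a (D y)) = fun y => r ^ G.weight k * a y := by
      funext y
      have := congrFun (G.leftInvariantField_dilation hr j y) k
      simpa [hD, dilation, anisotropicDilation] using this
    have h2 : HasFDerivAt (fun y => r ^ G.weight j * a (D y))
        (r ^ G.weight j • (fderiv ℝ a (D x)).comp D) x :=
      ((hd (D x)).hasFDerivAt.comp x D.hasFDerivAt).const_mul _
    have h3 : HasFDerivAt (fun y => r ^ G.weight k * a y) (r ^ G.weight k • fderiv ℝ a x) x :=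
      (hd x).hasFDerivAt.const_mul _
    rw [h1] at h2
    have h4 := congrArg (fun L => L (Pi.single k 1)) (h2.unique h3)
    simp only [ContinuousLinearMap.comp_apply, smul_apply, hD,
      anisotropicDilation_single, map_smul, smul_eq_mul] at h4
    have hrk : r ^ G.weight k ≠ 0 := (pow_pos hr _).ne'
    apply mul_left_cancel₀ hrk
    rw [← h4, dilation]; ring
  have hc : Continuous fun y => fderiv ℝ a y (Pi.single k 1) :=
    (hsm.continuous_fderiv (by simp)).clm_apply continuous_const
  have hlim : Filter.Tendsto (fun r : ℝ => r ^ G.weight j *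
      fderiv ℝ a (G.dilation r x) (Pi.single k 1)) (nhdsWithin 0 (Ioi 0)) (nhds 0) := by
    have h1 : Filter.Tendsto (fun r : ℝ => r ^ G.weight j) (nhdsWithin 0 (Ioi 0)) (nhds 0) := by
      have h := ((continuous_pow (M := ℝ) (G.weight j)).tendsto 0).mono_left
        (nhdsWithin_le_nhds (s := Ioi 0))
      have := G.one_le_weight j
      simpa [show G.weight j ≠ 0 by omega] using h
    simpa [dilation] using h1.mul ((hc.tendsto 0).comp
      (anisotropicDilation_tendsto_zero G.one_le_weight x))
  refine tendsto_nhds_unique (Filter.Tendsto.congr' ?_ tendsto_const_nhds) hlim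
  filter_upwards [self_mem_nhdsWithin] with r hr using (key r hr).symm

/-- The integral of `X_j f` vanishes for compactly supported `f`. -/
theorem integral_X_eq_zero (j : Fin n) {f : (Fin n → ℝ) → ℝ} (hf : ContDiff ℝ 1 f)
    (hc : HasCompactSupport f) : ∫ x, G.X j f x = 0 := by
  set a : Fin n → (Fin n → ℝ) → ℝ :=
    fun k y => leftInvariantField G.mul (Pi.single j 1) y k with ha
  have hsm : ∀ k, ContDiff ℝ ∞ (a k) := contDiff_pi.1 (G.contDiff_leftInvariantField _)
  have hX : ∀ x, G.X j f x = ∑ k, a k x * fderiv ℝ f x (Pi.single k 1) := by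
    intro x
    unfold X
    conv_lhs => rw [← Finset.univ_sum_single (leftInvariantField G.mul (Pi.single j 1) x)]
    rw [map_sum]
    refine Finset.sum_congr rfl fun k _ => ?_
    rw [show (Pi.single k (leftInvariantField G.mul (Pi.single j 1) x k) : Fin n → ℝ) =
      a k x • Pi.single k 1 by rw [← Pi.single_smul]; simp [ha], map_smul, smul_eq_mul]
  have hfd : ∀ v, Continuous fun x => fderiv ℝ f x v := fun v =>
    (hf.continuous_fderiv (by simp)).clm_apply continuous_const
  have hfc : ∀ v, HasCompactSupport fun x => fderiv ℝ f x v := fun v => hc.fderiv_apply ℝ v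
  have hint : ∀ k, Integrable fun x => a k x * fderiv ℝ f x (Pi.single k 1) := fun k =>
    ((hsm k).continuous.mul (hfd _)).integrable_of_hasCompactSupport (hfc _).mul_left
  simp only [hX]
  rw [integral_finsetSum _ fun k _ => hint k]
  refine Finset.sum_eq_zero fun k _ => ?_
  rw [integral_mul_fderiv_eq_neg_fderiv_mul_of_integrable _ (hint k)]
  · simp [ha, fderiv_leftInvariantField_diag]
  · exact ((hsm k).continuous.mul hf.continuous).integrable_of_hasCompactSupport hc.mul_left
  · exact fun x _ => (hsm k).differentiable (by simp) x
  · exact fun x _ => hf.differentiable (by simp) x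
  · simp [ha, fderiv_leftInvariantField_diag]

/-! ### Calculus of horizontal derivatives -/

variable {G}

theorem X_mul (j : Fin n) {f g : (Fin n → ℝ) → ℝ} {x : Fin n → ℝ}
    (hf : DifferentiableAt ℝ f x) (hg : DifferentiableAt ℝ g x) :
    G.X j (fun y => f y * g y) x = f x * G.X j g x + G.X j f x * g x := by
  simp [X, fderiv_fun_mul hf hg, mul_comm]

theorem X_comp (j : Fin n) {h : ℝ → ℝ} {f : (Fin n → ℝ) → ℝ} {x : Fin n → ℝ} {h' : ℝ}
    (hh : HasDerivAt h h' (f x)) (hf : DifferentiableAt ℝ f x) :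
    G.X j (fun y => h (f y)) x = h' * G.X j f x := by
  have := (hh.comp_hasFDerivAt x hf.hasFDerivAt).fderiv
  simp only [X]
  rw [show (fun y => h (f y)) = h ∘ f from rfl, this]
  simp

theorem X_congr (j : Fin n) {f g : (Fin n → ℝ) → ℝ} {x : Fin n → ℝ}
    (h : f =ᶠ[nhds x] g) : G.X j f x = G.X j g x := by
  simp [X, h.fderiv_eq]

theorem contDiffOn_X (j : Fin n) {f : (Fin n → ℝ) → ℝ} {s : Set (Fin n → ℝ)} (hs : IsOpen s)
    (hf : ContDiffOn ℝ ∞ f s) : ContDiffOn ℝ ∞ (G.X j f) s :=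
  (hf.fderiv_of_isOpen hs (by simp)).clm_apply (G.contDiff_leftInvariantField _).contDiffOn

theorem contDiff_X (j : Fin n) {f : (Fin n → ℝ) → ℝ} (hf : ContDiff ℝ ∞ f) :
    ContDiff ℝ ∞ (G.X j f) :=
  contDiffOn_univ.1 (contDiffOn_X j isOpen_univ hf.contDiffOn)

theorem tsupport_X_subset (j : Fin n) (f : (Fin n → ℝ) → ℝ) :
    tsupport (G.X j f) ⊆ tsupport f := by
  refine closure_minimal (fun x hx => ?_) (isClosed_tsupport f)
  refine support_fderiv_subset ℝ (f := f) fun h => hx ?_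
  simp [X, h]

theorem gradNorm_sq (f : (Fin n → ℝ) → ℝ) (x : Fin n → ℝ) :
    G.gradNorm f x ^ 2 = ∑ j ∈ G.horizontal, G.X j f x ^ 2 :=
  Real.sq_sqrt (Finset.sum_nonneg fun _ _ => sq_nonneg _)

theorem gradNorm_nonneg (f : (Fin n → ℝ) → ℝ) (x : Fin n → ℝ) : 0 ≤ G.gradNorm f x :=
  Real.sqrt_nonneg _

theorem contDiffOn_gradNorm_sq {f : (Fin n → ℝ) → ℝ} {s : Set (Fin n → ℝ)} (hs : IsOpen s)
    (hf : ContDiffOn ℝ ∞ f s) : ContDiffOn ℝ ∞ (fun x => G.gradNorm f x ^ 2) s := by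
  simp only [gradNorm_sq]
  exact ContDiffOn.sum fun j _ => (contDiffOn_X j hs hf).pow 2

theorem continuousOn_gradNorm {f : (Fin n → ℝ) → ℝ} {s : Set (Fin n → ℝ)} (hs : IsOpen s)
    (hf : ContDiffOn ℝ ∞ f s) : ContinuousOn (G.gradNorm f) s :=
  (continuousOn_finsetSum _ fun j _ => (contDiffOn_X j hs hf).continuousOn.pow 2).sqrt

theorem tsupport_gradNorm_subset (f : (Fin n → ℝ) → ℝ) :
    tsupport (G.gradNorm f) ⊆ tsupport f := by
  refine closure_minimal (fun x hx => ?_) (isClosed_tsupport f)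
  refine support_fderiv_subset ℝ (f := f) fun h => hx ?_
  simp [gradNorm, X, h]

theorem gradNorm_comp {h : ℝ → ℝ} {f : (Fin n → ℝ) → ℝ} {x : Fin n → ℝ} {h' : ℝ}
    (hh : HasDerivAt h h' (f x)) (hf : DifferentiableAt ℝ f x) :
    G.gradNorm (fun y => h (f y)) x = |h'| * G.gradNorm f x := by
  simp only [gradNorm, X_comp _ hh hf, mul_pow, ← Finset.mul_sum]
  rw [Real.sqrt_mul (sq_nonneg _), Real.sqrt_sq_eq_abs]

/-- Cauchy-Schwarz for the finite sum over the first layer. -/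
theorem gradInner_le (f g : (Fin n → ℝ) → ℝ) (x : Fin n → ℝ) :
    |G.gradInner f g x| ≤ G.gradNorm f x * G.gradNorm g x := by
  refine abs_le_of_sq_le_sq ?_ (mul_nonneg (gradNorm_nonneg _ _) (gradNorm_nonneg _ _))
  rw [mul_pow, gradNorm_sq, gradNorm_sq]
  exact Finset.sum_mul_sq_le_sq_mul_sq _ _ _

end CarnotGroup

/-! ### Products with functions supported away from the origin -/

section Punctured

variable {n : ℕ}

/-- Off the support of ψ the product is locally zero, so the behaviour of g at the origin is
irrelevant. This lets powers of N and ∇_G N be treated as smooth weights. -/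
theorem contDiff_mul_of_tsupport_subset {m : WithTop ℕ∞} {g ψ : (Fin n → ℝ) → ℝ}
    (hg : ContDiffOn ℝ m g {0}ᶜ) (hψ : ContDiff ℝ m ψ) (hs : tsupport ψ ⊆ {0}ᶜ) :
    ContDiff ℝ m fun x => g x * ψ x := by
  refine contDiff_iff_contDiffAt.2 fun x => ?_
  by_cases hx : x ∈ tsupport ψ
  · exact (hg.contDiffAt (isOpen_compl_singleton.mem_nhds (hs hx))).mul hψ.contDiffAt
  · refine (contDiffAt_const (c := (0 : ℝ))).congr_of_eventuallyEq ?_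
    exact (notMem_tsupport_iff_eventuallyEq.1 hx).mono fun y hy => by simp [hy]

theorem continuous_mul_of_tsupport_subset {g ψ : (Fin n → ℝ) → ℝ}
    (hg : ContinuousOn g {0}ᶜ) (hψ : Continuous ψ) (hs : tsupport ψ ⊆ {0}ᶜ) :
    Continuous fun x => g x * ψ x :=
  contDiff_zero.1 <| contDiff_mul_of_tsupport_subset (contDiffOn_zero.2 hg)
    (contDiff_zero.2 hψ) hs

theorem integrable_mul_of_tsupport_subset {g ψ : (Fin n → ℝ) → ℝ}
    (hg : ContinuousOn g {0}ᶜ) (hψ : Continuous ψ) (hc : HasCompactSupport ψ)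
    (hs : tsupport ψ ⊆ {0}ᶜ) : Integrable fun x => g x * ψ x :=
  (continuous_mul_of_tsupport_subset hg hψ hs).integrable_of_hasCompactSupport hc.mul_left

end Punctured

/-! ### Integration by parts and harmonicity off the origin -/

namespace CarnotGroup

variable {n : ℕ} {G : CarnotGroup n}

theorem continuous_X (j : Fin n) {f : (Fin n → ℝ) → ℝ} (hf : ContDiff ℝ 1 f) :
    Continuous (G.X j f) :=
  (hf.continuous_fderiv (by simp)).clm_apply (G.contDiff_leftInvariantField _).continuous

theorem hasCompactSupport_X (j : Fin n) {f : (Fin n → ℝ) → ℝ} (hf : HasCompactSupport f) :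
    HasCompactSupport (G.X j f) :=
  hf.of_isClosed_subset (isClosed_tsupport _) (tsupport_X_subset j f)

/-- Integration by parts for `X_j` away from the origin. -/
theorem integral_X_mul_eq_neg (j : Fin n) {F ψ : (Fin n → ℝ) → ℝ}
    (hF : ContDiffOn ℝ ∞ F {0}ᶜ) (hψ : ContDiff ℝ 1 ψ) (hc : HasCompactSupport ψ)
    (hs : tsupport ψ ⊆ {0}ᶜ) :
    ∫ x, G.X j F x * ψ x = -∫ x, F x * G.X j ψ x := by
  have hprod : ∀ x, G.X j (fun y => F y * ψ y) x = F x * G.X j ψ x + G.X j F x * ψ x := by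
    intro x
    by_cases hx : x ∈ tsupport ψ
    · exact X_mul j ((hF.contDiffAt (isOpen_compl_singleton.mem_nhds (hs hx))).differentiableAt
        (by simp)) (hψ.differentiable (by simp) x)
    · have h0 : ψ =ᶠ[nhds x] 0 := notMem_tsupport_iff_eventuallyEq.1 hx
      have h1 : (fun y => F y * ψ y) =ᶠ[nhds x] 0 := h0.mono fun y hy => by simp [hy]
      have hz : G.X j (0 : (Fin n → ℝ) → ℝ) x = 0 := by simp [X]
      rw [X_congr j h1, X_congr j h0, h0.eq_of_nhds, hz]
      simp
  have hF1 : Integrable fun x => F x * G.X j ψ x :=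
    integrable_mul_of_tsupport_subset hF.continuousOn (continuous_X j hψ)
      (hasCompactSupport_X j hc) ((tsupport_X_subset j ψ).trans hs)
  have hF2 : Integrable fun x => G.X j F x * ψ x :=
    integrable_mul_of_tsupport_subset (contDiffOn_X j isOpen_compl_singleton hF).continuousOn
      hψ.continuous hc hs
  have h := G.integral_X_eq_zero j (contDiff_mul_of_tsupport_subset
    (hF.of_le (by simp)) hψ hs) hc.mul_left
  simp only [hprod] at h
  rw [integral_add hF1 hF2] at h
  linarith

theorem contDiffOn_subLaplacian {f : (Fin n → ℝ) → ℝ} {s : Set (Fin n → ℝ)} (hs : IsOpen s)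
    (hf : ContDiffOn ℝ ∞ f s) : ContDiffOn ℝ ∞ (G.subLaplacian f) s :=
  ContDiffOn.sum fun j _ => contDiffOn_X j hs (contDiffOn_X j hs hf)

/-- A fundamental solution that is smooth away from the origin is harmonic there. -/
theorem IsFundamentalSolution.subLaplacian_eq_zero {u : (Fin n → ℝ) → ℝ}
    (hu : G.IsFundamentalSolution u) (hsm : ContDiffOn ℝ ∞ u {0}ᶜ) {x : Fin n → ℝ}
    (hx : x ≠ 0) : G.subLaplacian u x = 0 := by
  have hop : IsOpen ({0}ᶜ : Set (Fin n → ℝ)) := isOpen_compl_singleton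
  have hcont := (contDiffOn_subLaplacian (G := G) hop hsm).continuousOn
  -- Test functions supported off the origin do not see δ_0; two integrations by parts move Δ_G onto
  -- u. Continuity then upgrades the almost everywhere statement.
  have hae : ∀ᵐ x, x ∈ ({0}ᶜ : Set (Fin n → ℝ)) → G.subLaplacian u x = 0 := by
    refine hop.ae_eq_zero_of_integral_contDiff_smul_eq_zero
      (hcont.locallyIntegrableOn hop.measurableSet) fun φ hφ hc hs => ?_
    have hφX : ∀ j, ContDiff ℝ ∞ (G.X j φ) := fun j => contDiff_X j hφ
    have hj : ∀ j, ∫ x, G.X j (G.X j u) x * φ x = ∫ x, u x * G.X j (G.X j φ) x := by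
      intro j
      rw [integral_X_mul_eq_neg j (contDiffOn_X j hop hsm) (hφ.of_le (by simp)) hc hs,
        integral_X_mul_eq_neg j hsm ((hφX j).of_le (by simp)) (hasCompactSupport_X j hc)
          ((tsupport_X_subset j φ).trans hs), neg_neg]
    have h0 : φ 0 = 0 := image_eq_zero_of_notMem_tsupport fun h => hs h rfl
    have hw := hu.weak_eq φ hφ hc
    rw [h0, neg_eq_zero] at hw
    simp only [subLaplacian, Finset.mul_sum] at hw
    rw [integral_finsetSum] at hw
    · simp only [subLaplacian, smul_eq_mul, Finset.mul_sum]
      rw [integral_finsetSum]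
      · rw [← hw]
        refine Finset.sum_congr rfl fun j _ => ?_
        rw [← hj j]
        simp only [mul_comm]
      · intro j _
        simp only [mul_comm (φ _)]
        exact integrable_mul_of_tsupport_subset
          (contDiffOn_X j hop (contDiffOn_X j hop hsm)).continuousOn hφ.continuous hc hs
    · intro j _
      exact integrable_mul_of_tsupport_subset hsm.continuousOn
        (contDiff_X j (hφX j)).continuous
        (hasCompactSupport_X j (hasCompactSupport_X j hc))
        ((tsupport_X_subset j _).trans ((tsupport_X_subset j _).trans hs))
  have := Measure.eqOn_open_of_ae_eq (μ := volume) (f := G.subLaplacian u) (g := 0)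
    ((ae_restrict_iff' hop.measurableSet).2 hae) hop hcont continuousOn_const
  exact this hx

/-! ### Homogeneous norms -/

namespace IsHomogeneousNorm

variable {N : (Fin n → ℝ) → ℝ}

theorem pos (hN : G.IsHomogeneousNorm N) {x : Fin n → ℝ} (hx : x ≠ 0) : 0 < N x :=
  (hN.nonneg x).lt_of_ne fun h => hx ((hN.eq_zero_iff x).1 h.symm)

theorem contDiffAt (hN : G.IsHomogeneousNorm N) {x : Fin n → ℝ} (hx : x ≠ 0) :
    ContDiffAt ℝ ∞ N x :=
  hN.smooth.contDiffAt (isOpen_compl_singleton.mem_nhds hx)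

theorem differentiableAt (hN : G.IsHomogeneousNorm N) {x : Fin n → ℝ} (hx : x ≠ 0) :
    DifferentiableAt ℝ N x :=
  (hN.contDiffAt hx).differentiableAt (by simp)

/-- The closed balls of a homogeneous norm are compact. -/
theorem isCompact_le (hN : G.IsHomogeneousNorm N) (R : ℝ) : IsCompact {x | N x ≤ R} := by
  obtain ⟨m, hm0, hm⟩ : ∃ m > 0, ∀ x : Fin n → ℝ, ‖x‖ = 1 → m ≤ N x := by
    rcases (Metric.sphere (0 : Fin n → ℝ) 1).eq_empty_or_nonempty with he | hne
    · refine ⟨1, one_pos, fun x hx => ?_⟩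
      have : x ∈ Metric.sphere (0 : Fin n → ℝ) 1 := by simpa using hx
      simp [he] at this
    · obtain ⟨y, hy, hmin⟩ := (isCompact_sphere (0 : Fin n → ℝ) 1).exists_isMinOn hne
        hN.continuous.continuousOn
      have hy0 : y ≠ 0 := by rintro rfl; simp at hy
      exact ⟨N y, hN.pos hy0, fun x hx => hmin (by simpa using hx)⟩
  -- If ‖y‖ ≥ 1, some dilation with factor s ≤ 1 puts y on the Euclidean unit sphere, where N ≥ m;
  -- then m ≤ s N(y) ≤ N(y).
  have hball : ∀ y, N y < m → ‖y‖ < 1 := by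
    intro y hy
    by_contra! h1
    have hc : Continuous fun s : ℝ => ‖anisotropicDilation G.weight s y‖ := by
      unfold anisotropicDilation; fun_prop
    have h00 : ‖anisotropicDilation G.weight 0 y‖ = 0 := by
      rw [norm_eq_zero]; funext i
      have := G.one_le_weight i
      simp [anisotropicDilation, show G.weight i ≠ 0 by omega]
    have h11 : ‖anisotropicDilation G.weight 1 y‖ = ‖y‖ := by
      congr 1; funext i; simp [anisotropicDilation]
    obtain ⟨s, hs, hs1⟩ := intermediate_value_Icc zero_le_one hc.continuousOn
      (show (1 : ℝ) ∈ _ by rw [h00, h11]; exact ⟨zero_le_one, h1⟩)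
    have hs0 : 0 < s := hs.1.lt_of_ne (by rintro rfl; exact zero_ne_one (h00.symm.trans hs1))
    have := hm _ hs1
    have h2 := hN.dilation s hs0 y
    rw [CarnotGroup.dilation] at h2
    nlinarith [hs.2, hN.nonneg y]
  refine Metric.isCompact_of_isClosed_isBounded (isClosed_le hN.continuous continuous_const) ?_
  set R' := max R 1
  have hR' : 0 < R' := lt_max_of_lt_right one_pos
  -- With this r, N(x) ≤ R forces N(δ_r x) ≤ m/2 < m, so δ_r x lies in the Euclidean unit ball.
  set r := m / (2 * R')
  have hr : 0 < r := by positivity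
  refine (Metric.isBounded_closedBall (x := (0 : Fin n → ℝ)) (r := ∑ i, (r ^ G.weight i)⁻¹)).subset
    fun x hx => ?_
  have h1 : ‖G.dilation r x‖ < 1 := by
    apply hball
    rw [hN.dilation r hr]
    have : r * N x ≤ r * R' := by
      have : N x ≤ R := hx
      gcongr; exact this.trans (le_max_left _ _)
    have h2 : r * R' = m / 2 := by simp only [r]; field_simp
    linarith
  rw [mem_closedBall_zero_iff, pi_norm_le_iff_of_nonneg (by positivity)]
  intro i
  have h3 := (norm_le_pi_norm (G.dilation r x) i).trans h1.le
  have h4 : (0 : ℝ) < r ^ G.weight i := by positivity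
  simp only [CarnotGroup.dilation, anisotropicDilation, norm_mul, Real.norm_eq_abs,
    abs_of_pos h4] at h3
  have h5 : |x i| ≤ (r ^ G.weight i)⁻¹ := by
    rw [inv_eq_one_div, le_div_iff₀ h4]; linarith
  exact h5.trans (Finset.single_le_sum (f := fun i => (r ^ G.weight i)⁻¹)
    (fun _ _ => by positivity) (Finset.mem_univ i))

end IsHomogeneousNorm

/-! ### The gauge of Folland's solution -/

namespace IsFollandSolution

variable {u : (Fin n → ℝ) → ℝ}

/-- Since Q ≠ 2, the power 2-Q can be inverted, and the gauge is the very norm furnished by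
Folland's form of u. -/
theorem isHomogeneousNorm_gauge (hu : G.IsFollandSolution u) (hQ : 3 ≤ G.homDim) :
    G.IsHomogeneousNorm (G.gauge u) := by
  obtain ⟨N, hN, h⟩ := hu.eq_norm_rpow
  have hQ' : (2 - (G.homDim : ℝ)) ≠ 0 := by
    have : (3 : ℝ) ≤ G.homDim := by exact_mod_cast hQ
    linarith
  have : G.gauge u = N := by
    funext x
    by_cases hx : x = 0
    · simp [gauge, hx, (hN.eq_zero_iff 0).2 rfl]
    · rw [gauge, if_neg hx, h x hx, ← Real.rpow_mul (hN.nonneg x), mul_one_div_cancel hQ',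
        Real.rpow_one]
  rwa [this]

theorem eq_gauge_rpow (hu : G.IsFollandSolution u) (hQ : 3 ≤ G.homDim) {x : Fin n → ℝ}
    (hx : x ≠ 0) : u x = G.gauge u x ^ (2 - (G.homDim : ℝ)) := by
  obtain ⟨N, hN, h⟩ := hu.eq_norm_rpow
  have hQ' : (2 - (G.homDim : ℝ)) ≠ 0 := by
    have : (3 : ℝ) ≤ G.homDim := by exact_mod_cast hQ
    linarith
  have h0 : 0 ≤ u x := by rw [h x hx]; exact Real.rpow_nonneg (hN.nonneg x) _
  rw [gauge, if_neg hx, ← Real.rpow_mul h0, one_div_mul_cancel hQ', Real.rpow_one]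

/-- The gauge satisfies `N Δ_G N = (Q - 1) |∇_G N|²` away from the origin. -/
theorem gauge_mul_subLaplacian (hu : G.IsFollandSolution u) (hQ : 3 ≤ G.homDim)
    {x : Fin n → ℝ} (hx : x ≠ 0) :
    G.gauge u x * G.subLaplacian (G.gauge u) x =
      ((G.homDim : ℝ) - 1) * G.gradNorm (G.gauge u) x ^ 2 := by
  have hQ' : (3 : ℝ) ≤ G.homDim := by exact_mod_cast hQ
  set Q : ℝ := (G.homDim : ℝ) with hQdef
  have hN := hu.isHomogeneousNorm_gauge hQ
  set N := G.gauge u with hNdef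
  have hop : IsOpen ({0}ᶜ : Set (Fin n → ℝ)) := isOpen_compl_singleton
  have heq : ∀ y ≠ 0, u y = N y ^ (2 - Q) := fun y hy => hu.eq_gauge_rpow hQ hy
  have hsm : ContDiffOn ℝ ∞ u {0}ᶜ :=
    (hN.smooth.rpow_const_of_ne fun y hy => (hN.pos hy).ne').congr heq
  have hX1 : ∀ j, ∀ y ≠ 0, G.X j u y = (2 - Q) * N y ^ (1 - Q) * G.X j N y := by
    intro j y hy
    have h1 : u =ᶠ[nhds y] fun z => N z ^ (2 - Q) := by
      filter_upwards [hop.mem_nhds hy] with z hz using heq z hz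
    rw [X_congr j h1, X_comp (h := fun t => t ^ (2 - Q)) j
      (Real.hasDerivAt_rpow_const (Or.inl (hN.pos hy).ne')) (hN.differentiableAt hy)]
    ring_nf
  have hX2 : ∀ j, G.X j (G.X j u) x = (2 - Q) * N x ^ (-Q) *
      ((1 - Q) * G.X j N x ^ 2 + N x * G.X j (G.X j N) x) := by
    intro j
    have h1 : G.X j u =ᶠ[nhds x] fun y => (2 - Q) * N y ^ (1 - Q) * G.X j N y := by
      filter_upwards [hop.mem_nhds hx] with z hz using hX1 j z hz
    have hd := (Real.hasDerivAt_rpow_const (p := 1 - Q) (Or.inl (hN.pos hx).ne')).const_mul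
      (2 - Q)
    rw [X_congr j h1, X_mul (f := fun y => (2 - Q) * N y ^ (1 - Q)) j
      (hd.differentiableAt.comp x (hN.differentiableAt hx))
      (((contDiffOn_X j hop hN.smooth).contDiffAt (hop.mem_nhds hx)).differentiableAt (by simp)),
      X_comp (h := fun t => (2 - Q) * t ^ (1 - Q)) j hd (hN.differentiableAt hx)]
    rw [show N x ^ (1 - Q) = N x ^ (-Q) * N x by
      rw [← Real.rpow_add_one (hN.pos hx).ne']; ring_nf,
      show 1 - Q - 1 = -Q by ring]
    ring
  have hΔ := hu.fundamental.subLaplacian_eq_zero hsm hx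
  simp only [subLaplacian, hX2] at hΔ
  rw [← Finset.mul_sum, Finset.sum_add_distrib, ← Finset.mul_sum, ← Finset.mul_sum,
    mul_eq_zero, ← gradNorm_sq] at hΔ
  -- This is the common factor of Δ_G(N^{2-Q}); cancelling it leaves (1-Q)|∇_G N|² + N Δ_G N = 0.
  have hne : (2 - Q) * N x ^ (-Q) ≠ 0 :=
    mul_ne_zero (by linarith) (Real.rpow_pos_of_pos (hN.pos hx) _).ne'
  have := hΔ.resolve_left hne
  rw [subLaplacian]
  linarith

end IsFollandSolution

end CarnotGroup

/-! ### The Hardy inequality -/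

namespace CarnotGroup

variable {n : ℕ} {G : CarnotGroup n} {N : (Fin n → ℝ) → ℝ}

/-- The shift by ε keeps the base positive at zeros of ∇_G N, so even negative β is allowed. -/
theorem IsHomogeneousNorm.contDiffOn_gradNorm_sq_add_rpow (hN : G.IsHomogeneousNorm N) {ε : ℝ}
    (hε : 0 < ε) (β : ℝ) : ContDiffOn ℝ ∞ (fun x => (G.gradNorm N x ^ 2 + ε) ^ β) {0}ᶜ :=
  ((contDiffOn_gradNorm_sq isOpen_compl_singleton hN.smooth).add
    contDiffOn_const).rpow_const_of_ne fun x _ => by positivity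

theorem IsHomogeneousNorm.contDiffOn_rpow (hN : G.IsHomogeneousNorm N) (q : ℝ) :
    ContDiffOn ℝ ∞ (fun x => N x ^ q) {0}ᶜ :=
  hN.smooth.rpow_const_of_ne fun _ hx => (hN.pos hx).ne'

/-- The horizontal divergence of `(|∇N|² + ε)^β N^{1-p} ∇N` for an `∞`-harmonic gauge. -/
theorem IsHomogeneousNorm.sum_X_weighted_gradient (hN : G.IsHomogeneousNorm N) {Q : ℝ}
    (hΔ : ∀ x ≠ 0, N x * G.subLaplacian N x = (Q - 1) * G.gradNorm N x ^ 2)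
    (hinf : ∀ x ≠ 0, G.gradInner (fun y => G.gradNorm N y ^ 2) N x = 0)
    (p β : ℝ) {ε : ℝ} (hε : 0 < ε) {x : Fin n → ℝ} (hx : x ≠ 0) :
    ∑ j ∈ G.horizontal, G.X j
      (fun y => (G.gradNorm N y ^ 2 + ε) ^ β * N y ^ (1 - p) * G.X j N y) x =
      (Q - p) * ((G.gradNorm N x ^ 2 + ε) ^ β * G.gradNorm N x ^ 2 * N x ^ (-p)) := by
  have hop : IsOpen ({0}ᶜ : Set (Fin n → ℝ)) := isOpen_compl_singleton
  set s : (Fin n → ℝ) → ℝ := fun y => G.gradNorm N y ^ 2 with hs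
  have hsε : s x + ε ≠ 0 := by positivity
  have hNx := hN.pos hx
  have hds : DifferentiableAt ℝ s x := ((contDiffOn_gradNorm_sq hop hN.smooth).contDiffAt
    (hop.mem_nhds hx)).differentiableAt (by simp)
  have hh : HasDerivAt (fun t : ℝ => (t + ε) ^ β) (β * (s x + ε) ^ (β - 1)) (s x) := by
    simpa using ((hasDerivAt_id (s x)).add_const ε).rpow_const (p := β) (Or.inl hsε)
  have hk : HasDerivAt (fun t : ℝ => t ^ (1 - p)) ((1 - p) * N x ^ (1 - p - 1)) (N x) :=
    Real.hasDerivAt_rpow_const (Or.inl hNx.ne')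
  have hdA : DifferentiableAt ℝ (fun y => (s y + ε) ^ β) x :=
    hh.differentiableAt.comp x hds
  have hdB : DifferentiableAt ℝ (fun y => N y ^ (1 - p)) x :=
    hk.differentiableAt.comp x (hN.differentiableAt hx)
  have key : ∀ j, G.X j (fun y => (s y + ε) ^ β * N y ^ (1 - p) * G.X j N y) x =
      (s x + ε) ^ β * N x ^ (1 - p) * G.X j (G.X j N) x
        + (1 - p) * (s x + ε) ^ β * N x ^ (-p) * G.X j N x ^ 2
        + β * (s x + ε) ^ (β - 1) * N x ^ (1 - p) * (G.X j s x * G.X j N x) := by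
    intro j
    rw [X_mul (f := fun y => (s y + ε) ^ β * N y ^ (1 - p)) j (hdA.mul hdB)
      (((contDiffOn_X j hop hN.smooth).contDiffAt (hop.mem_nhds hx)).differentiableAt (by simp)),
      X_mul j hdA hdB, X_comp (h := fun t : ℝ => (t + ε) ^ β) j hh hds,
      X_comp (h := fun t : ℝ => t ^ (1 - p)) j hk (hN.differentiableAt hx),
      show 1 - p - 1 = -p by ring]
    ring
  have hi := hinf x hx
  have hd := hΔ x hx
  rw [gradInner] at hi
  rw [subLaplacian] at hd
  refine (Finset.sum_congr rfl fun j _ => key j).trans ?_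
  simp only [Finset.sum_add_distrib, ← Finset.mul_sum]
  -- The derivative of the regularised weight enters only through the `∞`-harmonic term, which is
  -- zero. The coefficients Q-1 from Δ_G N and 1-p from N^{1-p} add up to Q-p.
  rw [hi, ← gradNorm_sq, show N x ^ (1 - p) = N x ^ (-p) * N x by
      rw [← Real.rpow_add_one hNx.ne']; ring_nf]
  simp only [hs]
  linear_combination (G.gradNorm N x ^ 2 + ε) ^ β * N x ^ (-p) * hd

/-- The divergence theorem for `(|∇N|² + ε)^β N^{1-p} ∇N` tested against `ψ`. -/
theorem IsHomogeneousNorm.integral_weighted_gradient (hN : G.IsHomogeneousNorm N) {Q : ℝ}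
    (hΔ : ∀ x ≠ 0, N x * G.subLaplacian N x = (Q - 1) * G.gradNorm N x ^ 2)
    (hinf : ∀ x ≠ 0, G.gradInner (fun y => G.gradNorm N y ^ 2) N x = 0)
    (p β : ℝ) {ε : ℝ} (hε : 0 < ε) {ψ : (Fin n → ℝ) → ℝ}
    (hψ : ContDiff ℝ 1 ψ) (hc : HasCompactSupport ψ) (hs : tsupport ψ ⊆ {0}ᶜ) :
    (Q - p) * ∫ x, (G.gradNorm N x ^ 2 + ε) ^ β * G.gradNorm N x ^ 2 * N x ^ (-p) * ψ x =
      -∫ x, (G.gradNorm N x ^ 2 + ε) ^ β * N x ^ (1 - p) * G.gradInner N ψ x := by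
  have hop : IsOpen ({0}ᶜ : Set (Fin n → ℝ)) := isOpen_compl_singleton
  set F : Fin n → (Fin n → ℝ) → ℝ :=
    fun j y => (G.gradNorm N y ^ 2 + ε) ^ β * N y ^ (1 - p) * G.X j N y with hFdef
  have hF : ∀ j, ContDiffOn ℝ ∞ (F j) {0}ᶜ := fun j =>
    ((hN.contDiffOn_gradNorm_sq_add_rpow hε β).mul (hN.contDiffOn_rpow _)).mul (contDiffOn_X j hop hN.smooth)
  have h1 : ∑ j ∈ G.horizontal, ∫ x, G.X j (F j) x * ψ x =
      -∑ j ∈ G.horizontal, ∫ x, F j x * G.X j ψ x := by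
    rw [← Finset.sum_neg_distrib]
    exact Finset.sum_congr rfl fun j _ => integral_X_mul_eq_neg j (hF j) hψ hc hs
  rw [← integral_finsetSum, ← integral_finsetSum] at h1
  · rw [← integral_const_mul]
    convert h1 using 1
    · refine integral_congr_ae (Filter.Eventually.of_forall fun x => ?_)
      simp only
      by_cases hx : x = 0
      · have : ψ x = 0 := image_eq_zero_of_notMem_tsupport fun h => hs h hx
        simp [this]
      · rw [← Finset.sum_mul, hN.sum_X_weighted_gradient hΔ hinf p β hε hx]
        ring
    · simp only [hFdef, gradInner, Finset.mul_sum, _root_.mul_assoc]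
  · intro j _
    exact integrable_mul_of_tsupport_subset (hF j).continuousOn (continuous_X j hψ)
      (hasCompactSupport_X j hc) ((tsupport_X_subset j ψ).trans hs)
  · intro j _
    exact integrable_mul_of_tsupport_subset
      (contDiffOn_X j hop (hF j)).continuousOn hψ.continuous hc hs

theorem continuous_gradNorm {f : (Fin n → ℝ) → ℝ} (hf : ContDiff ℝ ∞ f) :
    Continuous (G.gradNorm f) :=
  continuousOn_univ.1 (continuousOn_gradNorm isOpen_univ hf.contDiffOn)

theorem hasCompactSupport_gradNorm {f : (Fin n → ℝ) → ℝ} (hf : HasCompactSupport f) :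
    HasCompactSupport (G.gradNorm f) :=
  hf.of_isClosed_subset (isClosed_tsupport _) (tsupport_gradNorm_subset f)

theorem integrable_gradNorm_rpow {f : (Fin n → ℝ) → ℝ} (hf : ContDiff ℝ ∞ f)
    (hc : HasCompactSupport f) {p : ℝ} (hp : 0 < p) :
    Integrable fun x => G.gradNorm f x ^ p :=
  ((continuous_gradNorm hf).rpow_const fun _ => Or.inr hp.le).integrable_of_hasCompactSupport
    ((hasCompactSupport_gradNorm hc).comp_left (g := fun t : ℝ => t ^ p)
      (Real.zero_rpow hp.ne'))

theorem IsHomogeneousNorm.integrable_hardy_weight (hN : G.IsHomogeneousNorm N)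
    {φ : (Fin n → ℝ) → ℝ} (hφ : IsPuncturedTestFunction φ) {p : ℝ} (hp : 0 < p) :
    Integrable fun x => G.gradNorm N x ^ p / N x ^ p * |φ x| ^ p := by
  have hop : IsOpen ({0}ᶜ : Set (Fin n → ℝ)) := isOpen_compl_singleton
  have h0 : |(0 : ℝ)| ^ p = 0 := by simp [hp.ne']
  refine integrable_mul_of_tsupport_subset (ContinuousOn.div ?_ ?_ ?_)
    (hφ.smooth.continuous.abs.rpow_const fun _ => Or.inr hp.le)
    (hφ.compact.comp_left (g := fun t : ℝ => |t| ^ p) h0)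
    ((closure_mono (Function.support_comp_subset (g := fun t : ℝ => |t| ^ p) h0 φ)).trans
      hφ.support)
  · exact (continuousOn_gradNorm hop hN.smooth).rpow_const fun _ _ => Or.inr hp.le
  · exact hN.continuous.continuousOn.rpow_const fun _ _ => Or.inr hp.le
  · exact fun x hx => (Real.rpow_pos_of_pos (hN.pos hx) _).ne'

/-- Bound for the regularised weight: `(t² + ε)^{(p-2)/2} t^k ≤ (t² + 1)^{(p-2+k)/2}`. -/
theorem _root_.Real.add_rpow_mul_pow_le {t ε p : ℝ} (ht : 0 ≤ t) (hε : 0 < ε) (hε1 : ε ≤ 1)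
    (k : ℕ) (hk : 0 ≤ p - 2 + k) :
    (t ^ 2 + ε) ^ ((p - 2) / 2) * t ^ k ≤ (t ^ 2 + 1) ^ ((p - 2 + k) / 2) := by
  have h0 : 0 < t ^ 2 + ε := by positivity
  -- For p < 2 the weight has a negative exponent; absorbing t^k first makes the total exponent
  -- nonnegative, so ε can be raised to 1.
  have h1 : t ^ k ≤ (t ^ 2 + ε) ^ ((k : ℝ) / 2) := by
    calc t ^ k = (t ^ 2) ^ ((k : ℝ) / 2) := by
          rw [← Real.rpow_natCast t 2, ← Real.rpow_mul ht, ← Real.rpow_natCast]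
          congr 1; push_cast; ring
      _ ≤ _ := Real.rpow_le_rpow (by positivity) (by linarith) (by positivity)
  calc (t ^ 2 + ε) ^ ((p - 2) / 2) * t ^ k
      ≤ (t ^ 2 + ε) ^ ((p - 2) / 2) * (t ^ 2 + ε) ^ ((k : ℝ) / 2) := by gcongr
    _ = (t ^ 2 + ε) ^ ((p - 2 + k) / 2) := by rw [← Real.rpow_add h0]; ring_nf
    _ ≤ _ := Real.rpow_le_rpow h0.le (by linarith) (by linarith)

theorem _root_.Real.tendsto_add_rpow_mul_pow {t p : ℝ} (ht : 0 ≤ t) (k : ℕ) (hk0 : k ≠ 0)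
    (hk : p - 2 + k ≠ 0) {e : ℕ → ℝ} (he : Filter.Tendsto e Filter.atTop (nhds 0)) :
    Filter.Tendsto (fun i => (t ^ 2 + e i) ^ ((p - 2) / 2) * t ^ k) Filter.atTop
      (nhds (t ^ (p - 2 + k))) := by
  rcases ht.eq_or_lt with rfl | ht
  -- At t = 0 the weight may blow up with i, but the factor 0^k is exactly zero since k ≠ 0.
  · simp [hk0, Real.zero_rpow hk]
  · have h1 : t ^ (p - 2 + k) = (t ^ 2 + 0) ^ ((p - 2) / 2) * t ^ k := by
      rw [Real.rpow_add ht, Real.rpow_natCast, add_zero, ← Real.rpow_natCast t 2,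
        ← Real.rpow_mul ht.le]
      congr 2; push_cast; ring
    rw [h1]
    refine Filter.Tendsto.mul_const _ (Filter.Tendsto.rpow_const (tendsto_const_nhds.add he) ?_)
    exact Or.inl (by positivity)

/-- The regularised weights pass to the limit under the integral. -/
theorem IsHomogeneousNorm.tendsto_integral_regularised (hN : G.IsHomogeneousNorm N)
    {p : ℝ} (k : ℕ) (hk0 : k ≠ 0) (hk : 0 < p - 2 + k) (q : ℝ) {η : (Fin n → ℝ) → ℝ}
    (hη : Continuous η) (hc : HasCompactSupport η) (hs : tsupport η ⊆ {0}ᶜ) :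
    Filter.Tendsto (fun i : ℕ => ∫ x, (G.gradNorm N x ^ 2 + 1 / ((i : ℝ) + 1)) ^ ((p - 2) / 2) *
        G.gradNorm N x ^ k * N x ^ q * η x) Filter.atTop
      (nhds (∫ x, G.gradNorm N x ^ (p - 2 + k) * N x ^ q * η x)) := by
  have hop : IsOpen ({0}ᶜ : Set (Fin n → ℝ)) := isOpen_compl_singleton
  have hNq := (hN.contDiffOn_rpow q).continuousOn
  have hg := continuousOn_gradNorm (G := G) hop hN.smooth
  refine tendsto_integral_of_dominated_convergence
    (fun x => (G.gradNorm N x ^ 2 + 1) ^ ((p - 2 + k) / 2) * N x ^ q * |η x|)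
    (fun i => ?_) ?_ (fun i => ?_) ?_
  · exact (integrable_mul_of_tsupport_subset
      (((hN.contDiffOn_gradNorm_sq_add_rpow (by positivity) _).continuousOn.mul (hg.pow k)).mul
        hNq) hη hc hs).aestronglyMeasurable
  · have h0 : |(0 : ℝ)| = 0 := abs_zero
    exact integrable_mul_of_tsupport_subset
      ((hN.contDiffOn_gradNorm_sq_add_rpow one_pos _).continuousOn.mul hNq) hη.abs
      (hc.comp_left h0) ((closure_mono (Function.support_comp_subset h0 η)).trans hs)
  · refine Filter.Eventually.of_forall fun x => ?_
    have hg0 := gradNorm_nonneg (G := G) N x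
    have hN0 := Real.rpow_nonneg (hN.nonneg x) q
    rw [norm_mul, Real.norm_eq_abs, Real.norm_eq_abs, abs_of_nonneg (by positivity)]
    gcongr
    refine Real.add_rpow_mul_pow_le hg0 (by positivity) ?_ k hk.le
    rw [div_le_one (by positivity)]
    linarith [(Nat.cast_nonneg i : (0 : ℝ) ≤ i)]
  · refine Filter.Eventually.of_forall fun x => ?_
    refine ((Real.tendsto_add_rpow_mul_pow (gradNorm_nonneg N x) k hk0 hk.ne' ?_).mul_const
      _).mul_const _
    exact tendsto_one_div_add_atTop_nhds_zero_nat

/-- Young's inequality in the form used for the Hardy inequality. -/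
theorem _root_.Real.young_rpow_sub_one {a b p : ℝ} (ha : 0 ≤ a) (hb : 0 ≤ b) (hp : 1 < p) :
    p * (a ^ (p - 1) * b) ≤ b ^ p + (p - 1) * a ^ p := by
  have h := Real.young_inequality_of_nonneg hb (Real.rpow_nonneg ha (p - 1))
    (Real.HolderConjugate.conjExponent hp)
  have hp1 : p - 1 ≠ 0 := by linarith
  rw [← Real.rpow_mul ha, Real.conjExponent, show (p - 1) * (p / (p - 1)) = p by field_simp] at h
  have hp0 : 0 < p := by linarith
  calc p * (a ^ (p - 1) * b) ≤ p * (b ^ p / p + a ^ p / (p / (p - 1))) := by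
        rw [mul_comm (a ^ (p - 1))]; gcongr
    _ = _ := by field_simp

/-- Cauchy-Schwarz and the chain rule; p > 1 makes |t|^p differentiable also at t = 0. -/
theorem abs_gradInner_abs_rpow_le {f φ : (Fin n → ℝ) → ℝ} (hφ : ContDiff ℝ ∞ φ) {p : ℝ}
    (hp : 1 < p) (x : Fin n → ℝ) :
    |G.gradInner f (fun y => |φ y| ^ p) x| ≤
      p * (G.gradNorm f x * (|φ x| ^ (p - 1) * G.gradNorm φ x)) := by
  have h1 := gradNorm_comp (G := G) (f := φ) (x := x) (hasDerivAt_abs_rpow (φ x) hp)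
    (hφ.differentiable (by simp) x)
  have h2 : |p * |φ x| ^ (p - 2) * φ x| = p * |φ x| ^ (p - 1) := by
    rw [abs_mul, abs_mul, abs_of_pos (by linarith : (0 : ℝ) < p),
      abs_of_nonneg (Real.rpow_nonneg (abs_nonneg _) _), _root_.mul_assoc,
      ← Real.rpow_add_one' (abs_nonneg _) (by linarith)]
    ring_nf
  refine (gradInner_le f _ x).trans_eq ?_
  rw [h1, h2]; ring

/-- The Hardy inequality for an `∞`-harmonic homogeneous norm with `N ΔN = (Q - 1) |∇N|²`. -/
theorem IsHomogeneousNorm.hardy (hN : G.IsHomogeneousNorm N) {Q : ℝ}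
    (hΔ : ∀ x ≠ 0, N x * G.subLaplacian N x = (Q - 1) * G.gradNorm N x ^ 2)
    (hinf : ∀ x ≠ 0, G.gradInner (fun y => G.gradNorm N y ^ 2) N x = 0)
    {p : ℝ} (hp : 1 < p) (hpQ : p < Q) {φ : (Fin n → ℝ) → ℝ} (hφ : IsPuncturedTestFunction φ) :
    ((Q - p) / p) ^ p * ∫ x, G.gradNorm N x ^ p / N x ^ p * |φ x| ^ p ≤
      ∫ x, G.gradNorm φ x ^ p := by
  have hp0 : 0 < p := by linarith
  have hop : IsOpen ({0}ᶜ : Set (Fin n → ℝ)) := isOpen_compl_singleton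
  have hg := continuousOn_gradNorm (G := G) hop hN.smooth
  have h0 : |(0 : ℝ)| ^ p = 0 := by simp [hp0.ne']
  set ψ : (Fin n → ℝ) → ℝ := fun x => |φ x| ^ p with hψdef
  have hψ : ContDiff ℝ 1 ψ := ContDiff.norm_rpow (hφ.smooth.of_le (by simp)) hp
  have hψc : HasCompactSupport ψ := hφ.compact.comp_left (g := fun t : ℝ => |t| ^ p) h0
  have hψs : tsupport ψ ⊆ {0}ᶜ :=
    (closure_mono (Function.support_comp_subset (g := fun t : ℝ => |t| ^ p) h0 φ)).trans
      hφ.support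
  set η : (Fin n → ℝ) → ℝ := fun x => |φ x| ^ (p - 1) * G.gradNorm φ x with hηdef
  have hη : Continuous η := (hφ.smooth.continuous.abs.rpow_const fun _ => Or.inr
    (by linarith)).mul (continuous_gradNorm hφ.smooth)
  have hηc : HasCompactSupport η := (hasCompactSupport_gradNorm hφ.compact).mul_left
  have hηs : tsupport η ⊆ {0}ᶜ :=
    (tsupport_mul_subset_right.trans (tsupport_gradNorm_subset φ)).trans hφ.support
  have hineq : ∀ i : ℕ, (Q - p) * ∫ x, (G.gradNorm N x ^ 2 + 1 / ((i : ℝ) + 1)) ^ ((p - 2) / 2) *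
      G.gradNorm N x ^ 2 * N x ^ (-p) * ψ x ≤
      p * ∫ x, (G.gradNorm N x ^ 2 + 1 / ((i : ℝ) + 1)) ^ ((p - 2) / 2) *
        G.gradNorm N x ^ 1 * N x ^ (1 - p) * η x := by
    intro i
    have hε : (0 : ℝ) < 1 / ((i : ℝ) + 1) := by positivity
    rw [hN.integral_weighted_gradient hΔ hinf p _ hε hψ hψc hψs, ← integral_const_mul,
      ← integral_neg]
    have hint : Integrable fun x => p * ((G.gradNorm N x ^ 2 + 1 / ((i : ℝ) + 1)) ^ ((p - 2) / 2) *
        G.gradNorm N x ^ 1 * N x ^ (1 - p) * η x) :=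
      (integrable_mul_of_tsupport_subset
        (((hN.contDiffOn_gradNorm_sq_add_rpow hε _).continuousOn.mul (hg.pow 1)).mul
          (hN.contDiffOn_rpow _).continuousOn) hη hηc hηs).const_mul p
    have hpt : ∀ x, |-((G.gradNorm N x ^ 2 + 1 / ((i : ℝ) + 1)) ^ ((p - 2) / 2) * N x ^ (1 - p) *
        G.gradInner N ψ x)| ≤ p * ((G.gradNorm N x ^ 2 + 1 / ((i : ℝ) + 1)) ^ ((p - 2) / 2) *
        G.gradNorm N x ^ 1 * N x ^ (1 - p) * η x) := by
      intro x
      have h1 := abs_gradInner_abs_rpow_le (G := G) (f := N) hφ.smooth hp x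
      have hw : 0 ≤ (G.gradNorm N x ^ 2 + 1 / ((i : ℝ) + 1)) ^ ((p - 2) / 2) * N x ^ (1 - p) :=
        mul_nonneg (by positivity) (Real.rpow_nonneg (hN.nonneg x) _)
      rw [abs_neg, abs_mul, abs_of_nonneg hw]
      refine (mul_le_mul_of_nonneg_left h1 hw).trans_eq ?_
      rw [hηdef]; ring
    exact (Real.le_norm_self _).trans
      (norm_integral_le_of_norm_le hint (Filter.Eventually.of_forall hpt))
  have hlim := le_of_tendsto_of_tendsto'
    ((hN.tendsto_integral_regularised (p := p) 2 two_ne_zero (by push_cast; linarith) (-p)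
      hψ.continuous hψc hψs).const_mul (Q - p))
    ((hN.tendsto_integral_regularised (p := p) 1 one_ne_zero (by push_cast; linarith) (1 - p)
      hη hηc hηs).const_mul p) hineq
  rw [show p - 2 + ((2 : ℕ) : ℝ) = p by push_cast; ring,
    show p - 2 + ((1 : ℕ) : ℝ) = p - 1 by push_cast; ring] at hlim
  set a := (Q - p) / p with ha
  have ha0 : 0 < a := div_pos (by linarith) hp0
  have hA : ∫ x, G.gradNorm N x ^ p * N x ^ (-p) * ψ x =
      ∫ x, G.gradNorm N x ^ p / N x ^ p * |φ x| ^ p := by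
    simp only [Real.rpow_neg (hN.nonneg _), div_eq_mul_inv, hψdef]
  rw [hA] at hlim
  -- Young's inequality for |∇_G φ| and a |∇_G N| |φ| / N. The factor a is chosen so that, after
  -- integration, p a^p copies of the Hardy integral stand against p - 1 of them times a^p, leaving
  -- exactly a^p.
  have hyoung : ∀ x, p * (a ^ (p - 1) * (G.gradNorm N x ^ (p - 1) * N x ^ (1 - p) * η x)) ≤
      G.gradNorm φ x ^ p +
        (p - 1) * (a ^ p * (G.gradNorm N x ^ p / N x ^ p * |φ x| ^ p)) := by
    intro x
    have hg0 := gradNorm_nonneg (G := G) N x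
    have hN0 := hN.nonneg x
    have hT : 0 ≤ G.gradNorm N x / N x := by positivity
    have h := Real.young_rpow_sub_one (a := a * (G.gradNorm N x / N x * |φ x|))
      (by positivity) (gradNorm_nonneg (G := G) φ x) hp
    rw [Real.mul_rpow ha0.le (by positivity), Real.mul_rpow ha0.le (by positivity),
      Real.mul_rpow hT (abs_nonneg _), Real.mul_rpow hT (abs_nonneg _),
      Real.div_rpow hg0 hN0, Real.div_rpow hg0 hN0] at h
    refine le_trans (le_of_eq ?_) h
    rw [show 1 - p = -(p - 1) by ring, Real.rpow_neg hN0, hηdef]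
    ring
  have hKint : Integrable fun x => G.gradNorm N x ^ (p - 1) * N x ^ (1 - p) * η x :=
    integrable_mul_of_tsupport_subset
      ((hg.rpow_const fun _ _ => Or.inr (by linarith)).mul (hN.contDiffOn_rpow _).continuousOn)
      hη hηc hηs
  have hBint := integrable_gradNorm_rpow (G := G) hφ.smooth hφ.compact hp0
  have hAint := hN.integrable_hardy_weight hφ hp0
  have hmono := integral_mono ((hKint.const_mul (a ^ (p - 1))).const_mul p)
    (hBint.add ((hAint.const_mul (a ^ p)).const_mul (p - 1))) hyoung
  rw [integral_const_mul, integral_const_mul, integral_add' hBint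
    ((hAint.const_mul (a ^ p)).const_mul (p - 1)), integral_const_mul, integral_const_mul] at hmono
  have hmul := mul_le_mul_of_nonneg_left hlim (Real.rpow_nonneg ha0.le (p - 1))
  have hap : a ^ p = a ^ (p - 1) * a := by rw [← Real.rpow_add_one ha0.ne']; ring_nf
  have hpa : Q - p = p * a := by rw [ha]; field_simp
  rw [hpa] at hmul
  have h1 : a ^ (p - 1) * (p * a * ∫ x, G.gradNorm N x ^ p / N x ^ p * |φ x| ^ p) =
      p * (a ^ p * ∫ x, G.gradNorm N x ^ p / N x ^ p * |φ x| ^ p) := by rw [hap]; ring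
  rw [h1] at hmul
  linarith

end CarnotGroup

/-! ### Dilations and polar coordinates -/

namespace CarnotGroup

variable {n : ℕ} {G : CarnotGroup n} {N : (Fin n → ℝ) → ℝ}

theorem dilation_zero (r : ℝ) : G.dilation r 0 = 0 := by
  funext i; simp [dilation, anisotropicDilation]

theorem dilation_ne_zero {r : ℝ} (hr : 0 < r) {x : Fin n → ℝ} (hx : x ≠ 0) :
    G.dilation r x ≠ 0 := by
  intro h
  refine hx (funext fun i => ?_)
  have := congrFun h i
  simpa [dilation, anisotropicDilation, hr.ne'] using this

/-- The horizontal derivatives of a homogeneous norm are homogeneous of degree zero. -/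
theorem IsHomogeneousNorm.X_dilation (hN : G.IsHomogeneousNorm N) {j : Fin n}
    (hj : j ∈ G.horizontal) {r : ℝ} (hr : 0 < r) {x : Fin n → ℝ} (hx : x ≠ 0) :
    G.X j N (G.dilation r x) = G.X j N x := by
  have hw : G.weight j = 1 := by simpa [horizontal] using hj
  set D := anisotropicDilationCLM G.weight r
  have hD : ∀ y, D y = G.dilation r y := anisotropicDilationCLM_apply _ _
  have h1 : (fun y => N (D y)) = fun y => r * N y := by
    funext y; rw [hD, hN.dilation r hr]
  have hDx : D x ≠ 0 := by rw [hD]; exact dilation_ne_zero hr hx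
  have h2 : HasFDerivAt (fun y => N (D y)) ((fderiv ℝ N (D x)).comp D) x :=
    (hN.differentiableAt hDx).hasFDerivAt.comp x D.hasFDerivAt
  have h3 : HasFDerivAt (fun y => r * N y) (r • fderiv ℝ N x) x :=
    (hN.differentiableAt hx).hasFDerivAt.const_mul _
  rw [h1] at h2
  have h4 := congrArg (fun L => L (leftInvariantField G.mul (Pi.single j 1) x)) (h2.unique h3)
  simp only [ContinuousLinearMap.comp_apply, smul_apply, hD, smul_eq_mul] at h4
  rw [← G.leftInvariantField_dilation hr j x, hw, pow_one, map_smul, smul_eq_mul] at h4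
  exact mul_left_cancel₀ hr.ne' h4

theorem IsHomogeneousNorm.gradNorm_dilation (hN : G.IsHomogeneousNorm N) {r : ℝ} (hr : 0 < r)
    (x : Fin n → ℝ) : G.gradNorm N (G.dilation r x) = G.gradNorm N x := by
  by_cases hx : x = 0
  · rw [hx, dilation_zero]
  · unfold gradNorm
    congr 1
    exact Finset.sum_congr rfl fun j hj => by rw [hN.X_dilation hj hr hx]

theorem measurable_dilation (r : ℝ) : Measurable (G.dilation r) := by
  unfold dilation anisotropicDilation
  fun_prop

theorem map_dilation_volume {r : ℝ} (hr : 0 < r) :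
    Measure.map (G.dilation r) volume = ENNReal.ofReal ((r ^ G.homDim)⁻¹) • volume := by
  have hdet : LinearMap.det (Matrix.toLin' (Matrix.diagonal fun i => r ^ G.weight i)) =
      r ^ G.homDim := by
    rw [LinearMap.det_toLin', Matrix.det_diagonal, homDim, Finset.prod_pow_eq_pow_sum]
  have h0 : 0 < r ^ G.homDim := pow_pos hr _
  have h := Real.map_linearMap_volume_pi_eq_smul_volume_pi
    (f := Matrix.toLin' (Matrix.diagonal fun i => r ^ G.weight i)) (by rw [hdet]; exact h0.ne')
  rw [hdet, abs_of_pos (inv_pos.2 h0)] at h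
  rw [← h]
  congr 1
  funext x i
  simp [dilation, anisotropicDilation, Matrix.mulVec_diagonal]

theorem lintegral_comp_dilation {r : ℝ} (hr : 0 < r) {F : (Fin n → ℝ) → ENNReal}
    (hF : Measurable F) :
    ENNReal.ofReal (r ^ G.homDim) * ∫⁻ x, F (G.dilation r x) = ∫⁻ x, F x := by
  have h0 : 0 < r ^ G.homDim := pow_pos hr _
  rw [← lintegral_map hF (measurable_dilation r), map_dilation_volume hr, lintegral_smul_measure,
    smul_eq_mul, ← _root_.mul_assoc, ← ENNReal.ofReal_mul h0.le, mul_inv_cancel₀ h0.ne']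
  simp

/-- The density `|∇_G N|^p N^{-Q}`. -/
noncomputable def polarDensity (G : CarnotGroup n) (N : (Fin n → ℝ) → ℝ) (p : ℝ)
    (x : Fin n → ℝ) : ℝ :=
  G.gradNorm N x ^ p * N x ^ (-(G.homDim : ℝ))

/-- The image under `log N` of the measure `|∇_G N|^p N^{-Q} dx`. -/
noncomputable def logPolarMeasure (G : CarnotGroup n) (N : (Fin n → ℝ) → ℝ) (p : ℝ) :
    Measure ℝ :=
  Measure.map (fun x => Real.log (N x))
    (volume.withDensity fun x => ENNReal.ofReal (G.polarDensity N p x))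

namespace IsHomogeneousNorm

theorem polarDensity_nonneg (hN : G.IsHomogeneousNorm N) (p : ℝ) (x : Fin n → ℝ) :
    0 ≤ G.polarDensity N p x :=
  mul_nonneg (Real.rpow_nonneg (gradNorm_nonneg _ _) _) (Real.rpow_nonneg (hN.nonneg x) _)

theorem polarDensity_zero (hN : G.IsHomogeneousNorm N) (hQ : G.homDim ≠ 0) (p : ℝ) :
    G.polarDensity N p 0 = 0 := by
  have : (-(G.homDim : ℝ)) ≠ 0 := neg_ne_zero.2 (by exact_mod_cast hQ)
  simp [polarDensity, (hN.eq_zero_iff 0).2 rfl, Real.zero_rpow this]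

theorem continuousOn_polarDensity (hN : G.IsHomogeneousNorm N) {p : ℝ} (hp : 0 < p) :
    ContinuousOn (G.polarDensity N p) {0}ᶜ :=
  ((continuousOn_gradNorm isOpen_compl_singleton hN.smooth).rpow_const
    fun _ _ => Or.inr hp.le).mul (hN.contDiffOn_rpow _).continuousOn

theorem measurable_polarDensity (hN : G.IsHomogeneousNorm N) {p : ℝ} (hp : 0 < p) :
    Measurable (G.polarDensity N p) :=
  measurable_of_continuousOn_compl_singleton 0 (hN.continuousOn_polarDensity hp)

theorem measurable_log (hN : G.IsHomogeneousNorm N) : Measurable fun x => Real.log (N x) :=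
  Real.measurable_log.comp hN.continuous.measurable

/-- |∇_G N| has degree 0, so only N^{-Q} scales, and it scales inversely to the Jacobian r^Q of the
dilation. -/
theorem polarDensity_dilation (hN : G.IsHomogeneousNorm N) {r : ℝ} (hr : 0 < r) (p : ℝ)
    (x : Fin n → ℝ) :
    G.polarDensity N p (G.dilation r x) = (r ^ G.homDim)⁻¹ * G.polarDensity N p x := by
  rw [polarDensity, polarDensity, hN.gradNorm_dilation hr, hN.dilation r hr,
    Real.mul_rpow hr.le (hN.nonneg x), Real.rpow_neg hr.le, Real.rpow_natCast]
  ring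

theorem logPolarMeasure_apply (hN : G.IsHomogeneousNorm N) (p : ℝ) {A : Set ℝ}
    (hA : MeasurableSet A) :
    G.logPolarMeasure N p A = ∫⁻ x, {x | Real.log (N x) ∈ A}.indicator
      (fun x => ENNReal.ofReal (G.polarDensity N p x)) x := by
  have hm : MeasurableSet {x | Real.log (N x) ∈ A} := hN.measurable_log hA
  rw [logPolarMeasure, Measure.map_apply hN.measurable_log hA, lintegral_indicator hm]
  exact withDensity_apply _ hm

/-- Dilation by e^t shifts log N by t, while density and Jacobian cancel. -/
theorem isAddLeftInvariant_logPolarMeasure (hN : G.IsHomogeneousNorm N) (hQ : G.homDim ≠ 0)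
    {p : ℝ} (hp : 0 < p) : (G.logPolarMeasure N p).IsAddLeftInvariant := by
  refine ⟨fun t => Measure.ext fun A hA => ?_⟩
  have hA' : MeasurableSet ((fun s => t + s) ⁻¹' A) := measurable_const_add t hA
  rw [Measure.map_apply (measurable_const_add t) hA, hN.logPolarMeasure_apply p hA,
    hN.logPolarMeasure_apply p hA']
  have hr := Real.exp_pos t
  have h0 : 0 < Real.exp t ^ G.homDim := pow_pos hr _
  have hmA : MeasurableSet {x | Real.log (N x) ∈ A} := hN.measurable_log hA
  rw [← lintegral_comp_dilation (G := G) hr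
    ((hN.measurable_polarDensity hp).ennreal_ofReal.indicator hmA),
    ← lintegral_const_mul]
  · refine lintegral_congr fun x => ?_
    -- Since `Real.log 0 = 0`, the shift of log N can fail at the origin; the density is zero there.
    by_cases hx : x = 0
    · subst hx
      rw [dilation_zero]
      simp [indicator, hN.polarDensity_zero hQ]
    · have hlog : Real.log (N (G.dilation (Real.exp t) x)) = t + Real.log (N x) := by
        rw [hN.dilation _ hr, Real.log_mul hr.ne' (hN.pos hx).ne', Real.log_exp]
      have hmem : G.dilation (Real.exp t) x ∈ {x | Real.log (N x) ∈ A} ↔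
          x ∈ {x | Real.log (N x) ∈ (fun s => t + s) ⁻¹' A} := by
        change Real.log (N (G.dilation (Real.exp t) x)) ∈ A ↔ t + Real.log (N x) ∈ A
        rw [hlog]
      by_cases hxA : x ∈ {x | Real.log (N x) ∈ (fun s => t + s) ⁻¹' A}
      · rw [indicator_of_mem hxA, indicator_of_mem (hmem.2 hxA), hN.polarDensity_dilation hr,
          ← ENNReal.ofReal_mul h0.le, mul_inv_cancel_left₀ h0.ne']
      · rw [indicator_of_notMem hxA, indicator_of_notMem (mt hmem.1 hxA), MulZeroClass.mul_zero]
  · exact ((hN.measurable_polarDensity hp).ennreal_ofReal.indicator hmA).comp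
      (measurable_dilation _)

/-- Shells of a homogeneous norm are compact. -/
theorem isCompact_shell (hN : G.IsHomogeneousNorm N) (a b : ℝ) :
    IsCompact {x | a ≤ N x ∧ N x ≤ b} :=
  (hN.isCompact_le b).of_isClosed_subset
    ((isClosed_le continuous_const hN.continuous).inter
      (isClosed_le hN.continuous continuous_const)) fun _ hx => hx.2

theorem shell_subset (hN : G.IsHomogeneousNorm N) {a : ℝ} (ha : 0 < a) (b : ℝ) :
    {x | a ≤ N x ∧ N x ≤ b} ⊆ {0}ᶜ := by
  rintro x hx rfl
  have := hx.1
  rw [(hN.eq_zero_iff 0).2 rfl] at this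
  linarith

theorem isFiniteMeasureOnCompacts_logPolarMeasure (hN : G.IsHomogeneousNorm N)
    (hQ : G.homDim ≠ 0) {p : ℝ} (hp : 0 < p) :
    IsFiniteMeasureOnCompacts (G.logPolarMeasure N p) := by
  refine ⟨fun K hK => ?_⟩
  obtain ⟨R, hR⟩ := hK.isBounded.subset_closedBall 0
  refine (measure_mono hR).trans_lt ?_
  rw [logPolarMeasure, Measure.map_apply hN.measurable_log Metric.isClosed_closedBall.measurableSet]
  set S := {x | Real.exp (-R) ≤ N x ∧ N x ≤ Real.exp R}
  have hS : IsCompact S := hN.isCompact_shell _ _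
  have hsub : (fun x => Real.log (N x)) ⁻¹' Metric.closedBall 0 R ⊆ S ∪ {0} := by
    intro x hx
    by_cases hx0 : x = 0
    · exact Or.inr hx0
    · left
      have hx' : |Real.log (N x)| ≤ R := by simpa using hx
      rw [abs_le] at hx'
      exact ⟨(Real.le_log_iff_exp_le (hN.pos hx0)).1 hx'.1,
        (Real.log_le_iff_le_exp (hN.pos hx0)).1 hx'.2⟩
  refine (measure_mono hsub).trans_lt ((measure_union_le _ _).trans_lt ?_)
  refine ENNReal.add_lt_top.2 ⟨?_, ?_⟩
  · rw [withDensity_apply _ hS.measurableSet]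
    exact (((hN.continuousOn_polarDensity hp).mono
      (hN.shell_subset (Real.exp_pos _) _)).integrableOn_compact hS).lintegral_lt_top
  · rw [withDensity_apply _ (measurableSet_singleton _), lintegral_singleton,
      hN.polarDensity_zero hQ]
    simp

/-- The horizontal gradient of the gauge of a fundamental solution cannot vanish identically. -/
theorem exists_gradNorm_ne_zero (hN : G.IsHomogeneousNorm N) {u : (Fin n → ℝ) → ℝ}
    (hu : G.IsFundamentalSolution u) : ∃ x ≠ 0, G.gradNorm N x ≠ 0 := by
  by_contra! hcon
  have hXN : ∀ j ∈ G.horizontal, ∀ x ≠ 0, G.X j N x = 0 := by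
    intro j hj x hx
    have h := gradNorm_sq (G := G) N x
    rw [hcon x hx, zero_pow two_ne_zero] at h
    have := (Finset.sum_eq_zero_iff_of_nonneg fun i _ => sq_nonneg (G.X i N x)).1 h.symm j hj
    exact pow_eq_zero_iff two_ne_zero |>.1 this
  -- A cutoff equal to 1 for t ≤ 1 and to 0 for t ≥ 2, so h ∘ N is constant near the origin, where N
  -- need not be smooth.
  set h : ℝ → ℝ := fun t => Real.smoothTransition (2 - t)
  have hh : ContDiff ℝ ∞ h := Real.smoothTransition.contDiff.comp (contDiff_const.sub contDiff_id)
  set f : (Fin n → ℝ) → ℝ := fun x => h (N x) with hf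
  have hN0 : N 0 = 0 := (hN.eq_zero_iff 0).2 rfl
  have hnear : f =ᶠ[nhds 0] fun _ => 1 := by
    have : ∀ᶠ x in nhds 0, N x < 1 :=
      hN.continuous.continuousAt.eventually_lt continuousAt_const (by simp [hN0])
    filter_upwards [this] with x hx
    exact Real.smoothTransition.one_of_one_le (by linarith)
  have hsm : ContDiff ℝ ∞ f := by
    refine contDiff_iff_contDiffAt.2 fun x => ?_
    by_cases hx : x = 0
    · subst hx
      exact contDiffAt_const.congr_of_eventuallyEq hnear
    · exact hh.contDiffAt.comp x (hN.contDiffAt hx)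
  have hc : HasCompactSupport f := by
    refine HasCompactSupport.intro (hN.isCompact_le 2) fun x hx => ?_
    have : 2 < N x := not_le.1 hx
    exact Real.smoothTransition.zero_of_nonpos (by linarith)
  have hXf : ∀ j ∈ G.horizontal, G.X j f = 0 := by
    intro j hj
    funext x
    by_cases hx : x = 0
    · subst hx
      rw [X_congr j hnear]
      simp [X]
    · rw [hf, X_comp j (hh.differentiable (by simp) _).hasDerivAt (hN.differentiableAt hx),
        hXN j hj x hx]
      simp
  have hΔ : ∀ x, G.subLaplacian f x = 0 := by
    intro x
    refine Finset.sum_eq_zero fun j hj => ?_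
    rw [hXf j hj]
    simp [X]
  have hw := hu.weak_eq f hsm hc
  rw [hnear.eq_of_nhds] at hw
  simp [hΔ] at hw

/-- Polar coordinates: in the variable `log N`, the measure `|∇_G N|^p N^{-Q} dx` is a positive
multiple of Lebesgue measure. -/
theorem exists_integral_comp_log (hN : G.IsHomogeneousNorm N) {u : (Fin n → ℝ) → ℝ}
    (hu : G.IsFundamentalSolution u) (hQ : G.homDim ≠ 0) {p : ℝ} (hp : 0 < p) :
    ∃ c : ℝ, 0 < c ∧ ∀ F : ℝ → ℝ, Measurable F →
      ∫ x, G.polarDensity N p x * F (Real.log (N x)) = c * ∫ t, F t := by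
  have := hN.isAddLeftInvariant_logPolarMeasure hQ hp
  have := hN.isFiniteMeasureOnCompacts_logPolarMeasure hQ hp
  -- Uniqueness of Haar measure on ℝ.
  have hν := Measure.isAddLeftInvariant_eq_smul (G.logPolarMeasure N p) volume
  set c := Measure.addHaarScalarFactor (G.logPolarMeasure N p) volume
  have hmd := (hN.measurable_polarDensity hp).ennreal_ofReal
  refine ⟨c, ?_, fun F hF => ?_⟩
  · rw [NNReal.coe_pos]
    refine pos_iff_ne_zero.2 fun hc => ?_
    rw [hc, zero_smul, logPolarMeasure,
      Measure.map_eq_zero_iff hN.measurable_log.aemeasurable,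
      withDensity_eq_zero_iff hmd.aemeasurable] at hν
    have hop : IsOpen ({0}ᶜ : Set (Fin n → ℝ)) := isOpen_compl_singleton
    have hz : EqOn (G.polarDensity N p) 0 {0}ᶜ := by
      refine Measure.eqOn_open_of_ae_eq (μ := volume) (ae_restrict_of_ae ?_) hop
        (hN.continuousOn_polarDensity hp) continuousOn_const
      filter_upwards [hν] with x hx
      exact le_antisymm (ENNReal.ofReal_eq_zero.1 hx) (hN.polarDensity_nonneg p x)
    obtain ⟨x, hx, hne⟩ := hN.exists_gradNorm_ne_zero hu
    have h1 := hz hx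
    have h2 : 0 < G.gradNorm N x := (gradNorm_nonneg N x).lt_of_ne hne.symm
    have h3 : 0 < G.polarDensity N p x :=
      mul_pos (Real.rpow_pos_of_pos h2 _) (Real.rpow_pos_of_pos (hN.pos hx) _)
    exact h3.ne' h1
  · have h1 : ∫ t, F t ∂(G.logPolarMeasure N p) = c * ∫ t, F t := by
      rw [hν, integral_smul_nnreal_measure]; rfl
    rw [← h1, logPolarMeasure, integral_map hN.measurable_log.aemeasurable
      hF.aestronglyMeasurable, integral_withDensity_eq_integral_toReal_smul hmd
        (Filter.Eventually.of_forall fun _ => ENNReal.ofReal_lt_top)]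
    simp only [ENNReal.toReal_ofReal (hN.polarDensity_nonneg p _), smul_eq_mul]

end IsHomogeneousNorm

end CarnotGroup

/-! ### Radial test functions and sharpness -/

namespace CarnotGroup

variable {n : ℕ} {G : CarnotGroup n} {N : (Fin n → ℝ) → ℝ}

/-- The radial profile `s ↦ s^{-a} χ(ε log s)`. -/
noncomputable def hardyProfile (χ : ℝ → ℝ) (a ε s : ℝ) : ℝ := s ^ (-a) * χ (ε * Real.log s)

theorem hasDerivAt_hardyProfile {χ : ℝ → ℝ} (hχ : ContDiff ℝ ∞ χ) (a ε : ℝ) {s : ℝ}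
    (hs : 0 < s) :
    HasDerivAt (hardyProfile χ a ε)
      (s ^ (-a - 1) * (ε * deriv χ (ε * Real.log s) - a * χ (ε * Real.log s))) s := by
  have h1 := Real.hasDerivAt_rpow_const (p := -a) (Or.inl hs.ne')
  have h2 : HasDerivAt (fun s => χ (ε * Real.log s))
      (deriv χ (ε * Real.log s) * (ε * s⁻¹)) s :=
    (hχ.differentiable (by simp) _).hasDerivAt.comp s ((Real.hasDerivAt_log hs.ne').const_mul ε)
  refine (h1.mul h2).congr_deriv ?_
  rw [Real.rpow_sub_one hs.ne']
  field_simp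
  ring

theorem contDiffAt_hardyProfile {χ : ℝ → ℝ} (hχ : ContDiff ℝ ∞ χ) (a ε : ℝ) {s : ℝ}
    (hs : 0 < s) : ContDiffAt ℝ ∞ (hardyProfile χ a ε) s :=
  (Real.contDiffAt_rpow_const_of_ne hs.ne').mul
    (hχ.contDiffAt.comp s (contDiffAt_const.mul (Real.contDiffAt_log.2 hs.ne')))

theorem IsHomogeneousNorm.tsupport_hardyProfile_subset (hN : G.IsHomogeneousNorm N) {χ : ℝ → ℝ}
    {R : ℝ} (hR : ∀ t, R < |t| → χ t = 0) {a ε : ℝ} (ha : a ≠ 0) (hε : 0 < ε) :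
    tsupport (fun x => hardyProfile χ a ε (N x)) ⊆
      {x | Real.exp (-(R / ε)) ≤ N x ∧ N x ≤ Real.exp (R / ε)} := by
  refine closure_minimal (fun x hx => ?_) (hN.isCompact_shell _ _).isClosed
  -- At the origin χ(ε log 0) = χ(0) need not vanish; the factor 0^{-a} does, because a ≠ 0.
  have hx0 : x ≠ 0 := by
    rintro rfl
    refine hx ?_
    simp [hardyProfile, (hN.eq_zero_iff 0).2 rfl, Real.zero_rpow (neg_ne_zero.2 ha)]
  have hχ : χ (ε * Real.log (N x)) ≠ 0 := right_ne_zero_of_mul hx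
  have h1 : |ε * Real.log (N x)| ≤ R := not_lt.1 fun h => hχ (hR _ h)
  rw [abs_mul, abs_of_pos hε, mul_comm, ← le_div_iff₀ hε, abs_le] at h1
  exact ⟨(Real.le_log_iff_exp_le (hN.pos hx0)).1 h1.1,
    (Real.log_le_iff_le_exp (hN.pos hx0)).1 h1.2⟩

theorem IsHomogeneousNorm.isPuncturedTestFunction_hardyProfile (hN : G.IsHomogeneousNorm N)
    {χ : ℝ → ℝ} (hχ : ContDiff ℝ ∞ χ) {R : ℝ} (hR : ∀ t, R < |t| → χ t = 0) {a ε : ℝ}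
    (ha : a ≠ 0) (hε : 0 < ε) :
    IsPuncturedTestFunction fun x => hardyProfile χ a ε (N x) := by
  have hsub := hN.tsupport_hardyProfile_subset hR ha hε
  have hsub0 := hsub.trans (hN.shell_subset (Real.exp_pos _) _)
  refine ⟨contDiff_iff_contDiffAt.2 fun x => ?_,
    (hN.isCompact_shell _ _).of_isClosed_subset (isClosed_tsupport _) hsub, hsub0⟩
  by_cases hx : x = 0
  · exact (contDiffAt_const (c := (0 : ℝ))).congr_of_eventuallyEq
      (notMem_tsupport_iff_eventuallyEq.1 fun h => hsub0 h hx)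
  · exact (contDiffAt_hardyProfile hχ a ε (hN.pos hx)).comp x (hN.contDiffAt hx)

/-- The two Hardy integrands of a radial profile in terms of the polar density. -/
theorem IsHomogeneousNorm.hardyProfile_integrands (hN : G.IsHomogeneousNorm N)
    (hQ : G.homDim ≠ 0) {χ : ℝ → ℝ} (hχ : ContDiff ℝ ∞ χ) {R : ℝ}
    (hR : ∀ t, R < |t| → χ t = 0) {p a ε : ℝ} (hp : 0 < p) (ha : a ≠ 0)
    (hap : (a + 1) * p = G.homDim) (hε : 0 < ε) (x : Fin n → ℝ) :
    G.gradNorm (fun x => hardyProfile χ a ε (N x)) x ^ p = G.polarDensity N p x *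
        |ε * deriv χ (ε * Real.log (N x)) - a * χ (ε * Real.log (N x))| ^ p ∧
      G.gradNorm N x ^ p / N x ^ p * |hardyProfile χ a ε (N x)| ^ p =
        G.polarDensity N p x * |χ (ε * Real.log (N x))| ^ p := by
  have hφ := hN.isPuncturedTestFunction_hardyProfile hχ hR ha hε
  by_cases hx : x = 0
  · subst hx
    rw [hN.polarDensity_zero hQ]
    have h1 : G.gradNorm (fun x => hardyProfile χ a ε (N x)) 0 = 0 :=
      image_eq_zero_of_notMem_tsupport fun h => hφ.support (tsupport_gradNorm_subset _ h) rfl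
    rw [h1, (hN.eq_zero_iff 0).2 rfl]
    simp [Real.zero_rpow hp.ne']
  · have hNx := hN.pos hx
    have hg0 := gradNorm_nonneg (G := G) N x
    have hpow : ∀ q : ℝ, 0 ≤ N x ^ q := fun q => Real.rpow_nonneg hNx.le q
    constructor
    · rw [gradNorm_comp (hasDerivAt_hardyProfile hχ a ε hNx) (hN.differentiableAt hx),
        Real.mul_rpow (abs_nonneg _) hg0, abs_mul, abs_of_nonneg (hpow _),
        Real.mul_rpow (hpow _) (abs_nonneg _), ← Real.rpow_mul hNx.le,
        show (-a - 1) * p = -(G.homDim : ℝ) by rw [← hap]; ring, polarDensity]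
      ring
    · rw [hardyProfile, abs_mul, abs_of_nonneg (hpow _),
        Real.mul_rpow (hpow _) (abs_nonneg _), ← Real.rpow_mul hNx.le, polarDensity,
        show -(G.homDim : ℝ) = -p + -a * p by rw [← hap]; ring, Real.rpow_add hNx,
        Real.rpow_neg hNx.le p]
      ring

/-- As `ε → 0`, the profile quotient tends to `a^p`. -/
theorem tendsto_integral_profile {χ : ℝ → ℝ} (hχ : ContDiff ℝ ∞ χ) (hc : HasCompactSupport χ)
    {a p : ℝ} (ha : 0 ≤ a) (hp : 0 < p) :
    Filter.Tendsto (fun i : ℕ => ∫ t, |1 / ((i : ℝ) + 1) * deriv χ t - a * χ t| ^ p) Filter.atTop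
      (nhds (a ^ p * ∫ t, |χ t| ^ p)) := by
  have hd : Continuous (deriv χ) := hχ.continuous_deriv (by simp)
  have hlim : a ^ p * ∫ t, |χ t| ^ p = ∫ t, |0 * deriv χ t - a * χ t| ^ p := by
    rw [← integral_const_mul]
    congr 1; funext t
    rw [MulZeroClass.zero_mul, zero_sub, abs_neg, abs_mul, abs_of_nonneg ha,
      Real.mul_rpow ha (abs_nonneg _)]
  rw [hlim]
  refine tendsto_integral_of_dominated_convergence
    (fun t => (|deriv χ t| + a * |χ t|) ^ p) (fun i => ?_) ?_ (fun i => ?_) ?_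
  · exact (((continuous_const.mul hd).sub (continuous_const.mul hχ.continuous)).abs.rpow_const
      fun _ => Or.inr hp.le).aestronglyMeasurable
  · refine Continuous.integrable_of_hasCompactSupport ((hd.abs.add
      (continuous_const.mul hχ.continuous.abs)).rpow_const fun _ => Or.inr hp.le) ?_
    refine HasCompactSupport.intro hc.isCompact fun t ht => ?_
    have h1 : χ t = 0 := image_eq_zero_of_notMem_tsupport ht
    have h2 : deriv χ t = 0 :=
      image_eq_zero_of_notMem_tsupport fun h => ht (tsupport_deriv_subset h)
    simp [h1, h2, Real.zero_rpow hp.ne']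
  · refine Filter.Eventually.of_forall fun t => ?_
    rw [Real.norm_of_nonneg (by positivity)]
    refine Real.rpow_le_rpow (abs_nonneg _) ?_ hp.le
    have hi : 1 / ((i : ℝ) + 1) ≤ 1 := by
      rw [div_le_one (by positivity)]
      linarith [(Nat.cast_nonneg i : (0 : ℝ) ≤ i)]
    calc |1 / ((i : ℝ) + 1) * deriv χ t - a * χ t|
        ≤ |1 / ((i : ℝ) + 1) * deriv χ t| + |a * χ t| := abs_sub _ _
      _ = 1 / ((i : ℝ) + 1) * |deriv χ t| + a * |χ t| := by
          rw [abs_mul, abs_mul, abs_of_nonneg ha, abs_of_nonneg (by positivity)]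
      _ ≤ |deriv χ t| + a * |χ t| := by
          gcongr
          exact mul_le_of_le_one_left (abs_nonneg _) hi
  · refine Filter.Eventually.of_forall fun t => ?_
    refine Filter.Tendsto.rpow_const (Filter.Tendsto.abs ?_) (Or.inr hp.le)
    exact (tendsto_one_div_add_atTop_nhds_zero_nat.mul_const _).sub_const _

/-- Sharpness of the constant in the Hardy inequality. -/
theorem IsHomogeneousNorm.hardy_sharp (hN : G.IsHomogeneousNorm N) {u : (Fin n → ℝ) → ℝ}
    (hu : G.IsFundamentalSolution u) {p : ℝ} (hp : 0 < p) (hpQ : p < G.homDim) {C : ℝ}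
    (hC : ∀ φ : (Fin n → ℝ) → ℝ, IsPuncturedTestFunction φ →
      C * ∫ x, G.gradNorm N x ^ p / N x ^ p * |φ x| ^ p ≤ ∫ x, G.gradNorm φ x ^ p) :
    C ≤ (((G.homDim : ℝ) - p) / p) ^ p := by
  have hQ : G.homDim ≠ 0 := by
    intro h; rw [h] at hpQ; simp at hpQ; linarith
  set a := ((G.homDim : ℝ) - p) / p with ha
  have ha0 : 0 < a := div_pos (by linarith) hp
  -- With this exponent both integrands carry exactly the power N^{-Q} of the dilation invariant
  -- measure.
  have hap : (a + 1) * p = G.homDim := by rw [ha]; field_simp; ring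
  obtain ⟨c, hc0, hc⟩ := hN.exists_integral_comp_log hu hQ hp
  let χ : ContDiffBump (0 : ℝ) := ⟨1, 2, one_pos, one_lt_two⟩
  have hχ : ContDiff ℝ ∞ χ := χ.contDiff
  have hχd : Continuous (deriv χ) := hχ.continuous_deriv (by simp)
  have hR : ∀ t, (2 : ℝ) < |t| → χ t = 0 := fun t ht => by
    apply χ.zero_of_le_dist
    simpa [Real.dist_eq] using ht.le
  have hineq : ∀ ε : ℝ, 0 < ε →
      C * ∫ t, |χ t| ^ p ≤ ∫ t, |ε * deriv χ t - a * χ t| ^ p := by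
    intro ε hε
    have h := hC _ (hN.isPuncturedTestFunction_hardyProfile hχ hR ha0.ne' hε)
    have hi := hN.hardyProfile_integrands hQ hχ hR hp ha0.ne' hap hε
    simp only [fun x => (hi x).1, fun x => (hi x).2] at h
    have hm1 : Measurable fun t => |χ (ε * t)| ^ p :=
      ((hχ.continuous.comp (continuous_const.mul continuous_id)).abs.rpow_const
        fun _ => Or.inr hp.le).measurable
    have hm2 : Measurable fun t => |ε * deriv χ (ε * t) - a * χ (ε * t)| ^ p :=
      (((continuous_const.mul (hχd.comp (continuous_const.mul continuous_id))).sub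
        (continuous_const.mul (hχ.continuous.comp
          (continuous_const.mul continuous_id)))).abs.rpow_const
        fun _ => Or.inr hp.le).measurable
    -- Rescaling t by ε puts the same factor c/ε on both sides; it cancels, and ε survives only in
    -- front of χ'.
    rw [hc _ hm1, hc _ hm2, Measure.integral_comp_mul_left (fun t => |χ t| ^ p) ε,
      Measure.integral_comp_mul_left (fun t => |ε * deriv χ t - a * χ t| ^ p) ε,
      smul_eq_mul, smul_eq_mul] at h
    have hk : 0 < c * |ε⁻¹| := mul_pos hc0 (abs_pos.2 (inv_ne_zero hε.ne'))
    refine le_of_mul_le_mul_left ?_ hk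
    calc _ = C * (c * (|ε⁻¹| * ∫ t, |χ t| ^ p)) := by ring
      _ ≤ _ := h
      _ = _ := by ring
  have hlim := ge_of_tendsto' (tendsto_integral_profile hχ χ.hasCompactSupport ha0.le hp)
    fun i : ℕ => hineq (1 / ((i : ℝ) + 1)) (by positivity)
  have hpos : 0 < ∫ t, |χ t| ^ p := by
    have hcont : Continuous fun t => |χ t| ^ p :=
      hχ.continuous.abs.rpow_const fun _ => Or.inr hp.le
    refine hcont.integral_pos_of_hasCompactSupport_nonneg_nonzero (x := 0) ?_
      (fun t => by positivity) ?_
    · exact χ.hasCompactSupport.comp_left (g := fun t : ℝ => |t| ^ p)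
        (by simp [Real.zero_rpow hp.ne'])
    · have : χ 0 = 1 := χ.one_of_mem_closedBall (by simp [χ])
      simp [this]
  exact le_of_mul_le_mul_right hlim hpos

end CarnotGroup

theorem theorem3p1 {n : ℕ} (G : CarnotGroup n) (hQ : 3 ≤ G.homDim) (hG : G.IsPolarizable)
    (u : (Fin n → ℝ) → ℝ) (hu : G.IsFollandSolution u)
    (p : ℝ) (hp1 : 1 < p) (hpQ : p < G.homDim) :
    (∀ φ : (Fin n → ℝ) → ℝ, IsPuncturedTestFunction φ →
      Integrable (fun x => G.gradNorm φ x ^ p) ∧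
      Integrable (fun x => G.gradNorm (G.gauge u) x ^ p / G.gauge u x ^ p * |φ x| ^ p) ∧
      (((G.homDim : ℝ) - p) / p) ^ p *
          ∫ x, G.gradNorm (G.gauge u) x ^ p / G.gauge u x ^ p * |φ x| ^ p ≤
        ∫ x, G.gradNorm φ x ^ p) ∧
    (∀ C : ℝ,
      (∀ φ : (Fin n → ℝ) → ℝ, IsPuncturedTestFunction φ →
        C * ∫ x, G.gradNorm (G.gauge u) x ^ p / G.gauge u x ^ p * |φ x| ^ p ≤
          ∫ x, G.gradNorm φ x ^ p) →
      C ≤ (((G.homDim : ℝ) - p) / p) ^ p) := by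
  have hN := hu.isHomogeneousNorm_gauge hQ
  have hp0 : 0 < p := by linarith
  refine ⟨fun φ hφ => ⟨CarnotGroup.integrable_gradNorm_rpow hφ.smooth hφ.compact hp0,
    hN.integrable_hardy_weight hφ hp0,
    hN.hardy (fun x hx => hu.gauge_mul_subLaplacian hQ hx) (fun x hx => ?_) hp1 hpQ hφ⟩,
    fun C hC => hN.hardy_sharp hu.fundamental hp0 hpQ hC⟩
  have h := hG u hu x hx
  rw [CarnotGroup.infSubLaplacian] at h
  linarith
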